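/- **Theorem (Decomposition theorem 1).** *Conventions.* A polytope is the convex hull of a finite set of points in some $\mathbb{R}^e$; a $d$-polytope ($d\ge 0$) is a nonempty polytope whose affine hull has dimension $d$. Let $\mathcal F(P)$ be the set of nonempty faces of $P$, including $P$ itself. A triangulation of $P$ is a finite collection $\mathcal C$ of simplices (including $\emptyset$) that contains every face of each of its members, in which the intersection of any two members is a face of both, and whose union is $P$. For $F\in\mathcal F(P)$ put $\mathcal C_F=\{Q\in\mathcal C : Q\subseteq F\}$. A triangulation $\mathcal C$ of $P$ is *pointed* with apexes $V(P)=(\mathbf v_F)_{F\in\mathcal F(P)}$ if 1. for every $F\in\mathcal F(P)$, $\mathcal C_F$ is a triangulation of $F$, $\mathbf v_F$ is a vertex of $F$, and $\mathbf v_F$ lies in every simplex of $\mathcal C_F$ of dimension $\dim F$; 2. for all $F_1,F_2\in\mathcal F(P)$, if $\mathbf v_{F_1},\mathbf v_{F_2}\in F_1\cap F_2$ then $\mathbf v_{F_1}=\mathbf v_{F_2}$; 3. for every $F\in\mathcal F(P)$ and every vertex $\mathbf w\neq\mathbf v_F$ of $F$, the segment $\mathrm{conv}\{\mathbf v_F,\mathbf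 w\}$ belongs to $\mathcal C_F$. The *$V(P)$-polytope numbers* $P(n)$ and *interior polytope numbers* $P(n)^\sharp$ ($n\ge 0$) are defined, for $P$ and likewise for each of its nonempty faces, by double induction on the dimension and $n$. In dimension $0$: $P(0)=P(0)^\sharp=0$ and $P(n)=P(n)^\sharp=1$ for $n\ge1$. In dimension $\ge 1$: $P(0)=0$, $P(1)=1$, $P(0)^\sharp=P(1)^\sharp=0$, and for $n\ge2$ $$P(n)=P(n-1)+\sum_{F\in\mathcal F(P),\ \mathbf v_P\notin F}F(n)^\sharp,\qquad P(n)^\sharp=P(n)-\sum_{F\in\mathcal F(P)\setminus\{P\}}F(n)^\sharp .$$ The *$d$-simplex numbers* are $\alpha^d(m)=\binom{m-1+d}{d}$ for integers $m\ge1$ and $\alpha^d(m)=0$ for integers $m\le 0$. *Statement.* Let $P$ be a $d$-polytope with a pointed triangulation with apexes $V(P)$, and let $P(n)$ be its $V(P)$-polytope numbers. Then there are nonnegative integers $a_1,\dots,a_{d-1}$ such that for all integers $n\ge0$ $$P(n)=\alpha^d(n)+\sum_{i=1}^{d-1}a_i\,\alpha^d(n-i)$$ (the sum being empty for $d\le1$).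 -/

import Mathlib

namespace PolytopeNumbers

noncomputable section

variable {E : Type*} [NormedAddCommGroup E] [NormedSpace ℝ E]

/-- A polytope: the convex hull of a finite set of points (the empty polytope is allowed). -/
def IsPolytope (P : Set E) : Prop :=
  ∃ s : Finset E, P = convexHull ℝ (s : Set E)

/-- The dimension of (the affine hull of) a nonempty set. The empty set gets the junk value `0`,
so nonemptiness is required wherever dimensions are used below. -/
def dim (P : Set E) : ℕ := Module.finrank ℝ (vectorSpan ℝ P)

/-- A `d`-polytope: a nonempty polytope whose affine hull has dimension `d`. -/
def IsDPolytope (d : ℕ) (P : Set E) : Prop :=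
  IsPolytope P ∧ P.Nonempty ∧ dim P = d

/-- `F` is a face of `P`: `F` is empty or the set of points of `P` at which some linear form
attains its maximum over `P`. Both `∅` and `P` are faces. -/
def IsFace (P F : Set E) : Prop := IsExposed ℝ P F

/-- The nonempty faces of `P`, including `P` itself. -/
def faces (P : Set E) : Set (Set E) := {F | IsFace P F ∧ F.Nonempty}

/-- The nonempty faces of `P` other than `P`. -/
def properFaces (P : Set E) : Set (Set E) := {F | F ∈ faces P ∧ F ≠ P}

/-- The vertices of `P`: the points `x` such that `{x}` is a face. -/
def vert (P : Set E) : Set E := {x | IsFace P {x}}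

/-- A simplex (possibly empty): the convex hull of an affinely independent finite set. -/
def IsSimplex (Q : Set E) : Prop :=
  ∃ s : Finset E, AffineIndependent ℝ ((↑) : s → E) ∧ Q = convexHull ℝ (s : Set E)

/-- A polytopal complex. -/
structure IsPolytopalComplex (C : Set (Set E)) : Prop where
  finite : C.Finite
  polytope : ∀ Q ∈ C, IsPolytope Q
  empty_mem : ∅ ∈ C
  face_mem : ∀ Q ∈ C, ∀ F, IsFace Q F → F ∈ C
  inter_face : ∀ Q ∈ C, ∀ Q' ∈ C, IsFace Q (Q ∩ Q') ∧ IsFace Q' (Q ∩ Q')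

/-- A triangulation of `P`: a polytopal complex of simplices with underlying set `P`. -/
structure IsTriangulation (P : Set E) (C : Set (Set E)) : Prop where
  complex : IsPolytopalComplex C
  sUnion_eq : ⋃₀ C = P
  simplex : ∀ Q ∈ C, IsSimplex Q

/-- The part of the complex `C` that lies in `F`. -/
def restrict (C : Set (Set E)) (F : Set E) : Set (Set E) := {Q ∈ C | Q ⊆ F}

/-- `C` is a pointed triangulation of `P`; the apex of a nonempty face `F` is `v F`. Only the
values of `v` on nonempty faces of `P` matter. -/
structure IsPointedTriangulation (P : Set E) (v : Set E → E) (C : Set (Set E)) : Prop where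
  triangulation : IsTriangulation P C
  /-- Each face is triangulated by the part of `C` in it. -/
  face_triangulation : ∀ F ∈ faces P, IsTriangulation F (restrict C F)
  /-- The apex of a face is one of its vertices. -/
  apex_mem_vert : ∀ F ∈ faces P, v F ∈ vert F
  /-- The apex of a face lies in every simplex of full dimension of its triangulation. -/
  apex_mem : ∀ F ∈ faces P, ∀ Q ∈ restrict C F, Q.Nonempty → dim Q = dim F → v F ∈ Q
  /-- Apexes are compatible. -/
  apex_eq : ∀ F₁ ∈ faces P, ∀ F₂ ∈ faces P,
    v F₁ ∈ F₁ ∩ F₂ → v F₂ ∈ F₁ ∩ F₂ → v F₁ = v F₂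
  /-- The apex of a face is joined to the other vertices of the face by edges. -/
  edge_mem : ∀ F ∈ faces P, ∀ w ∈ vert F, w ≠ v F → convexHull ℝ {v F, w} ∈ restrict C F

/-- Proper nonempty faces have smaller dimension; the recursion below rests on this. -/
theorem dim_lt_of_mem_properFaces [FiniteDimensional ℝ E] {P F : Set E}
    (h : F ∈ properFaces P) : dim F < dim P := by
  obtain ⟨⟨hF, hne⟩, hFP⟩ := h
  have hsub : F ⊆ P := hF.subset
  obtain ⟨l, hl⟩ := hF hne
  obtain ⟨x, hx⟩ := hne
  obtain ⟨y, hyP, hyF⟩ : ∃ y ∈ P, y ∉ F := by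
    by_contra! hc
    exact hFP (hsub.antisymm hc)
  have hxm : ∀ z ∈ P, l z ≤ l x := by rw [hl] at hx; exact hx.2
  have hconst : ∀ z ∈ F, l z = l x := by
    intro z hz
    refine le_antisymm (hxm z (hsub hz)) ?_
    rw [hl] at hz
    exact hz.2 x (hsub hx)
  have hyx : l y ≠ l x := by
    intro he
    apply hyF
    rw [hl]
    exact ⟨hyP, fun z hz => he ▸ hxm z hz⟩
  have hker : vectorSpan ℝ F ≤ LinearMap.ker l.toLinearMap := by
    rw [vectorSpan_def, Submodule.span_le]
    rintro _ ⟨a, ha, b, hb, rfl⟩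
    simp [hconst a ha, hconst b hb]
  apply Submodule.finrank_lt_finrank_of_lt
  refine lt_of_le_of_ne (vectorSpan_mono ℝ hsub) ?_
  intro he
  have hm : y -ᵥ x ∈ vectorSpan ℝ F := he ▸ vsub_mem_vectorSpan ℝ hyP (hsub hx)
  have := hker hm
  simp [sub_eq_zero] at this
  exact hyx this

mutual

/-- The polytope number `P(n)` with respect to the apexes `v F` of the nonempty faces `F` of `P`.
(A face that misses `v P ∈ P` is automatically proper.) -/
def polytopeNumber [FiniteDimensional ℝ E] (v : Set E → E) (P : Set E) : ℕ → ℤ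
  | 0 => 0
  | 1 => 1
  | n + 2 =>
    if dim P = 0 then 1
    else polytopeNumber v P (n + 1) +
      ∑ᶠ (F : Set E) (_ : F ∈ properFaces P ∩ {F | v P ∉ F}), interiorPolytopeNumber v F (n + 2)
  termination_by n => (dim P, n, 0)
  decreasing_by
    · exact Prod.Lex.right _ (Prod.Lex.left _ _ (by omega))
    · exact Prod.Lex.left _ _ (dim_lt_of_mem_properFaces (by rename_i h; exact h.1))

/-- The interior polytope number `P(n)^♯`. -/
def interiorPolytopeNumber [FiniteDimensional ℝ E] (v : Set E → E) (P : Set E) : ℕ → ℤ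
  | 0 => 0
  | 1 => if dim P = 0 then 1 else 0
  | n + 2 =>
    if dim P = 0 then 1
    else polytopeNumber v P (n + 2) -
      ∑ᶠ (F : Set E) (_ : F ∈ properFaces P), interiorPolytopeNumber v F (n + 2)
  termination_by n => (dim P, n, 1)
  decreasing_by
    · exact Prod.Lex.right _ (Prod.Lex.right _ (by omega))
    · exact Prod.Lex.left _ _ (dim_lt_of_mem_properFaces (by assumption))

end

/-- The `d`-simplex numbers `α^d(m) = C(m - 1 + d, d)` for `m ≥ 1`, and `α^d(m) = 0` for
`m ≤ 0`. -/
def simplexNumber (d : ℕ) (m : ℤ) : ℕ :=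
  if m ≤ 0 then 0 else (m.toNat - 1 + d).choose d

end

end PolytopeNumbers

/-!
View a triangulation of `P` from a point `q` of `P` in general position. Removing from every
full-dimensional simplex the facets visible from `q` leaves half-open simplices that partition `P`.
In each simplex count the points whose barycentric coordinates are multiples of `1 / (n - 1)`. A
half-open simplex with `i` removed facets contains `α^d(n - i)` of them, and only the simplex
containing `q` has `i = 0`, so the total is `α^d(n) + ∑ a_i α^d(n - i)`, where
`(1, a_1, a_2, …)` is the `h`-vector of the triangulation.

The total also satisfies the recursion of the polytope numbers. The triangulation is a cone with
apex `v P`, and the simplices missing `v P` are those in the relative interiors of the faces of `P`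
missing `v P`: a simplex meeting the relative interior of a face that contains `v P` has `v P` as a
vertex.

Finally `a_i = 0` for `i ≥ d`, since every vertex of the triangulation is a vertex of `P`. If all
facets of a full-dimensional simplex but the one opposite a vertex `x` were visible from `q`, then
a linear form with its maximum over `P` only at `x` would be even larger at `q`.
-/

namespace PolytopeNumbers

section BarycentricCoordinates

variable {E : Type*} [AddCommGroup E] [Module ℝ E]

/-- The barycentric coordinate at the vertex `x` of the simplex with vertex set `s`, as an affine
function on the whole space. Only its values on the affine span of `s` are canonical; it is `0` if
no such affine function exists. -/
noncomputable def baryCoord (s : Finset E) (x : E) : E →ᵃ[ℝ] ℝ :=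
  open Classical in
  if h : ∃ f : E →ᵃ[ℝ] ℝ, f x = 1 ∧ ∀ y ∈ s, y ≠ x → f y = 0 then h.choose else 0

variable {s t : Finset E} {x y p : E}

theorem baryCoord_spec (hs : AffineIndependent ℝ ((↑) : s → E)) (hx : x ∈ s) :
    baryCoord s x x = 1 ∧ ∀ y ∈ s, y ≠ x → baryCoord s x y = 0 := by
  have h : ∃ f : E →ᵃ[ℝ] ℝ, f x = 1 ∧ ∀ y ∈ s, y ≠ x → f y = 0 := by
    obtain ⟨u, hsu, hu, hspan⟩ := exists_subset_affineIndependent_affineSpan_eq_top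
      (s := (s : Set E)) hs
    let b : AffineBasis u ℝ E := ⟨(↑), hu, by rw [Subtype.range_coe, hspan]⟩
    refine ⟨b.coord ⟨x, hsu hx⟩, b.coord_apply_eq _, fun y hy hyx => ?_⟩
    exact b.coord_apply_ne (j := ⟨y, hsu hy⟩) fun e => hyx (congrArg Subtype.val e).symm
  rw [baryCoord, dif_pos h]
  exact h.choose_spec

theorem baryCoord_self (hs : AffineIndependent ℝ ((↑) : s → E)) (hx : x ∈ s) :
    baryCoord s x x = 1 := (baryCoord_spec hs hx).1

theorem baryCoord_of_ne (hs : AffineIndependent ℝ ((↑) : s → E)) (hx : x ∈ s) (hy : y ∈ s)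
    (hyx : y ≠ x) : baryCoord s x y = 0 := (baryCoord_spec hs hx).2 y hy hyx

theorem sum_baryCoord_smul_map {F : Type*} [AddCommGroup F] [Module ℝ F]
    (hs : AffineIndependent ℝ ((↑) : s → E)) (hp : p ∈ affineSpan ℝ (s : Set E))
    (f : E →ᵃ[ℝ] F) : ∑ x ∈ s, baryCoord s x p • f x = f p := by
  refine affineSpan_induction (p := fun p => ∑ x ∈ s, baryCoord s x p • f x = f p) hp
    (fun y hy => ?_) fun c u v w hu hv hw => ?_
  · rw [Finset.sum_eq_single_of_mem y hy fun x hx hxy => by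
      rw [baryCoord_of_ne hs hx hy hxy.symm, zero_smul], baryCoord_self hs hy, one_smul]
  · simp only [AffineMap.map_vadd, map_smul, AffineMap.linearMap_vsub]
    simp only [vsub_eq_sub, vadd_eq_add, smul_eq_mul, add_smul, mul_smul, sub_smul,
      Finset.sum_add_distrib, ← Finset.smul_sum, Finset.sum_sub_distrib, hu, hv, hw]

theorem sum_baryCoord (hs : AffineIndependent ℝ ((↑) : s → E))
    (hp : p ∈ affineSpan ℝ (s : Set E)) : ∑ x ∈ s, baryCoord s x p = 1 := by
  simpa using sum_baryCoord_smul_map hs hp (AffineMap.const ℝ E (1 : ℝ))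

theorem sum_baryCoord_smul (hs : AffineIndependent ℝ ((↑) : s → E))
    (hp : p ∈ affineSpan ℝ (s : Set E)) : ∑ x ∈ s, baryCoord s x p • x = p :=
  sum_baryCoord_smul_map hs hp (AffineMap.id ℝ E)

theorem baryCoord_nonneg (hs : AffineIndependent ℝ ((↑) : s → E)) (hx : x ∈ s)
    (hp : p ∈ convexHull ℝ (s : Set E)) : 0 ≤ baryCoord s x p := by
  refine convexHull_min (t := baryCoord s x ⁻¹' Set.Ici 0) (fun y hy => ?_)
    ((convex_Ici 0).affine_preimage _) hp
  rcases eq_or_ne y x with rfl | hyx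
  · simp [baryCoord_self hs hx]
  · simp [baryCoord_of_ne hs hx hy hyx]

theorem baryCoord_eq_zero (hs : AffineIndependent ℝ ((↑) : s → E)) (hx : x ∈ s) (hts : t ⊆ s)
    (hxt : x ∉ t) (hp : p ∈ affineSpan ℝ (t : Set E)) : baryCoord s x p = 0 := by
  refine AffineMap.eqOn_affineSpan (g := AffineMap.const ℝ E 0) (fun y hy => ?_) hp
  exact baryCoord_of_ne hs hx (hts hy) (ne_of_mem_of_not_mem hy hxt)

theorem mem_affineSpan_of_baryCoord_eq_zero (hs : AffineIndependent ℝ ((↑) : s → E))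
    (hts : t ⊆ s) (hp : p ∈ affineSpan ℝ (s : Set E))
    (h : ∀ x ∈ s, x ∉ t → baryCoord s x p = 0) : p ∈ affineSpan ℝ (t : Set E) := by
  have hsum : ∑ x ∈ t, baryCoord s x p = 1 := by
    rw [Finset.sum_subset hts h, sum_baryCoord hs hp]
  have hcomb : t.affineCombination ℝ id (fun x => baryCoord s x p) = p := by
    rw [t.affineCombination_eq_linear_combination _ _ hsum, Finset.sum_subset hts fun x hx hxt => by
      rw [h x hx hxt, zero_smul]]
    exact sum_baryCoord_smul hs hp
  rw [← hcomb]
  simpa using affineCombination_mem_affineSpan_image (s' := (t : Set E)) hsum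
    (fun x hx hxt => absurd hx hxt) id

theorem mem_convexHull_of_baryCoord_nonneg (hs : AffineIndependent ℝ ((↑) : s → E))
    (hp : p ∈ affineSpan ℝ (s : Set E)) (h : ∀ x ∈ s, 0 ≤ baryCoord s x p) :
    p ∈ convexHull ℝ (s : Set E) :=
  Finset.mem_convexHull'.2 ⟨_, h, sum_baryCoord hs hp, sum_baryCoord_smul hs hp⟩

theorem baryCoord_centroid_pos (hs : AffineIndependent ℝ ((↑) : s → E)) (hx : x ∈ s) (hts : t ⊆ s)
    (hxt : x ∈ t) : 0 < baryCoord s x (t.centroid ℝ id) := by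
  have hne : t.Nonempty := ⟨x, hxt⟩
  rw [Finset.centroid_def, Finset.map_affineCombination _ _ _
    (t.sum_centroidWeights_eq_one_of_nonempty ℝ hne), Finset.affineCombination_eq_linear_combination
    _ _ _ (t.sum_centroidWeights_eq_one_of_nonempty ℝ hne)]
  rw [Finset.sum_eq_single_of_mem x hxt fun y hy hyx => by
    simp [baryCoord_of_ne hs hx (hts hy) hyx]]
  simp [baryCoord_self hs hx, hne.card_pos]

end BarycentricCoordinates

section GenericPoints

variable {E : Type*} [AddCommGroup E] [Module ℝ E]

theorem subsingleton_setOf_lineMap_mem {A : AffineSubspace ℝ E} {p q : E} {r : ℝ}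
    (hr : AffineMap.lineMap p q r ∉ A) : {c : ℝ | AffineMap.lineMap p q c ∈ A}.Subsingleton := by
  intro a ha b hb
  by_contra hab
  have hr' : AffineMap.lineMap a b ((r - a) / (b - a)) = r := by
    rw [AffineMap.lineMap_apply_ring']
    field_simp [sub_ne_zero.2 (Ne.symm hab)]
    ring
  have hmem := AffineMap.lineMap_mem (Q := A.comap (AffineMap.lineMap p q))
    ((r - a) / (b - a)) ha hb
  rw [hr'] at hmem
  exact hr hmem

theorem mem_of_lineMap_mem {A : AffineSubspace ℝ E} {p q : E} {r : ℝ} (hr : r ≠ 0) (hp : p ∈ A)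
    (h : AffineMap.lineMap p q r ∈ A) : q ∈ A := by
  by_contra hq
  exact hr (subsingleton_setOf_lineMap_mem (p := p) (q := q) (r := 1) (by simpa using hq) h
    (by simpa using hp))

theorem exists_mem_forall_notMem {P : Set E} (hP : Convex ℝ P) (hne : P.Nonempty)
    {𝒜 : Set (AffineSubspace ℝ E)} (hfin : 𝒜.Finite) (h𝒜 : ∀ A ∈ 𝒜, ¬P ⊆ A) :
    ∃ p ∈ P, ∀ A ∈ 𝒜, p ∉ A := by
  induction 𝒜, hfin using Set.Finite.induction_on with
  | empty => exact ⟨hne.some, hne.some_mem, by simp⟩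
  | @insert A 𝒜 _ hfin ih =>
    obtain ⟨p, hp, hp𝒜⟩ := ih fun B hB => h𝒜 B (Set.mem_insert_of_mem _ hB)
    obtain ⟨q, hq, hqA⟩ := Set.not_subset.1 (h𝒜 A (Set.mem_insert _ _))
    have hbad : (⋃ B ∈ insert A 𝒜, {r : ℝ | AffineMap.lineMap p q r ∈ B}).Finite := by
      refine (hfin.insert A).biUnion fun B hB => Set.Subsingleton.finite ?_
      rcases hB with rfl | hB
      · exact subsingleton_setOf_lineMap_mem (r := 1) (by simpa using hqA)
      · exact subsingleton_setOf_lineMap_mem (r := 0) (by simpa using hp𝒜 B hB)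
    obtain ⟨r, hr, hrbad⟩ := (Set.Icc_infinite (zero_lt_one' ℝ)).exists_notMem_finite hbad
    refine ⟨AffineMap.lineMap p q r, hP.lineMap_mem hp hq hr, fun B hB hrB => hrbad ?_⟩
    exact Set.mem_biUnion hB hrB

end GenericPoints

section HalfOpenDecomposition

open Geometry Topology

section Module

variable {E : Type*} [AddCommGroup E] [Module ℝ E] {K : SimplicialComplex ℝ E} {s t : Finset E}
  {x p q : E}

theorem mem_of_baryCoord_pos (hs : s ∈ K.faces) (ht : t ∈ K.faces)
    (hps : p ∈ convexHull ℝ (s : Set E)) (hpt : p ∈ convexHull ℝ (t : Set E)) (hx : x ∈ s)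
    (h : 0 < baryCoord s x p) : x ∈ t := by
  classical
  by_contra hxt
  have hp := convexHull_subset_affineSpan _ (K.inter_subset_convexHull hs ht ⟨hps, hpt⟩)
  rw [← Finset.coe_inter] at hp
  exact h.ne' (baryCoord_eq_zero (K.indep hs) hx Finset.inter_subset_left
    (fun hm => hxt (Finset.mem_inter.1 hm).2) hp)

theorem subset_of_centroid_mem (hs : s ∈ K.faces) (ht : t ∈ K.faces)
    (h : s.centroid ℝ id ∈ convexHull ℝ (t : Set E)) : s ⊆ t := fun _ hx =>
  mem_of_baryCoord_pos hs ht (s.centroid_mem_convexHull (K.nonempty_of_mem_faces hs)) h hx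
    (baryCoord_centroid_pos (K.indep hs) hx subset_rfl hx)

theorem eq_of_baryCoord_pos (hs : s ∈ K.faces) (ht : t ∈ K.faces)
    (hps : p ∈ affineSpan ℝ (s : Set E)) (hpt : p ∈ affineSpan ℝ (t : Set E))
    (hs0 : ∀ x ∈ s, 0 < baryCoord s x p) (ht0 : ∀ x ∈ t, 0 < baryCoord t x p) : s = t := by
  have hs' := mem_convexHull_of_baryCoord_nonneg (K.indep hs) hps fun x hx => (hs0 x hx).le
  have ht' := mem_convexHull_of_baryCoord_nonneg (K.indep ht) hpt fun x hx => (ht0 x hx).le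
  exact Finset.Subset.antisymm (fun x hx => mem_of_baryCoord_pos hs ht hs' ht' hx (hs0 x hx))
    (fun x hx => mem_of_baryCoord_pos ht hs ht' hs' hx (ht0 x hx))

/-- The faces of `K` of full dimension, that is, those whose affine span contains `K.space`. -/
def spanningFaces (K : SimplicialComplex ℝ E) : Set (Finset E) :=
  {s ∈ K.faces | K.space ⊆ affineSpan ℝ (s : Set E)}

/-- A point of `K.space` in general position: the affine spans of the faces of `K` that are not of
full dimension all miss it. -/
def IsGeneric (K : SimplicialComplex ℝ E) (q : E) : Prop :=
  q ∈ K.space ∧ ∀ t ∈ K.faces, q ∈ affineSpan ℝ (t : Set E) → t ∈ spanningFaces K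

theorem exists_isGeneric (hfin : K.faces.Finite) (hK : Convex ℝ K.space)
    (hne : K.space.Nonempty) : ∃ q, IsGeneric K q := by
  obtain ⟨q, hq, h⟩ := exists_mem_forall_notMem hK hne
    (𝒜 := (fun t : Finset E => affineSpan ℝ (t : Set E)) '' (K.faces \ spanningFaces K))
    (hfin.sdiff.image _) (by
      rintro _ ⟨t, ⟨ht, hspan⟩, rfl⟩ hsub
      exact hspan ⟨ht, hsub⟩)
  refine ⟨q, hq, fun t ht hqt => ?_⟩
  by_contra hspan
  exact h _ ⟨t, ⟨ht, hspan⟩, rfl⟩ hqt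

theorem erase_notMem_spanningFaces [DecidableEq E] (hs : s ∈ K.faces) (hx : x ∈ s) :
    s.erase x ∉ spanningFaces K := by
  intro h
  have h0 := baryCoord_eq_zero (K.indep hs) hx (Finset.erase_subset x s) (Finset.notMem_erase x s)
    (h.2 (K.subset_space hs hx))
  rw [baryCoord_self (K.indep hs) hx] at h0
  exact one_ne_zero h0

theorem IsGeneric.baryCoord_ne_zero (hq : IsGeneric K q) (hs : s ∈ spanningFaces K) (hx : x ∈ s) :
    baryCoord s x q ≠ 0 := by
  classical
  intro h0
  have hqx : q ∈ affineSpan ℝ (s.erase x : Set E) := by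
    refine mem_affineSpan_of_baryCoord_eq_zero (K.indep hs.1) (Finset.erase_subset x s)
      (hs.2 hq.1) fun y hy hyx => ?_
    rwa [show y = x by simpa [hy] using hyx]
  have hne : (s.erase x).Nonempty := by
    rw [← Finset.coe_nonempty, ← affineSpan_nonempty ℝ]
    exact ⟨q, hqx⟩
  exact erase_notMem_spanningFaces hs.1 hx
    (hq.2 _ (K.down_closed hs.1 (Finset.erase_subset x s) hne) hqx)

/-- The vertices of `s` opposite to the facets of `s` that are visible from `q`. -/
noncomputable def visible (q : E) (s : Finset E) : Finset E := {x ∈ s | baryCoord s x q < 0}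

theorem visible_subset : visible q s ⊆ s := Finset.filter_subset _ _

theorem IsGeneric.baryCoord_pos (hq : IsGeneric K q) (hs : s ∈ spanningFaces K) (hx : x ∈ s)
    (hxv : x ∉ visible q s) : 0 < baryCoord s x q :=
  lt_of_le_of_ne (not_lt.1 fun h => hxv (Finset.mem_filter.2 ⟨hx, h⟩))
    (hq.baryCoord_ne_zero hs hx).symm

end Module

section Normed

variable {E : Type*} [NormedAddCommGroup E] [NormedSpace ℝ E] {K : SimplicialComplex ℝ E}
  {c p q : E} {s t Q : Finset E}

theorem exists_face_lineMap_mem (hfin : K.faces.Finite) (hK : Convex ℝ K.space)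
    (hc : c ∈ K.space) (hq : q ∈ K.space) :
    ∃ s ∈ K.faces, c ∈ convexHull ℝ (s : Set E) ∧
      ∃ r : ℝ, 0 < r ∧ AffineMap.lineMap c q r ∈ convexHull ℝ (s : Set E) := by
  have hmem : ∀ᶠ r : ℝ in 𝓝[>] 0, ∃ s ∈ K.faces,
      AffineMap.lineMap c q r ∈ convexHull ℝ (s : Set E) := by
    filter_upwards [Ioo_mem_nhdsGT zero_lt_one] with r hr
    exact SimplicialComplex.mem_space_iff.1 (hK.lineMap_mem hc hq ⟨hr.1.le, hr.2.le⟩)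
  obtain ⟨s, hs, hfreq⟩ : ∃ s ∈ K.faces,
      ∃ᶠ r : ℝ in 𝓝[>] 0, AffineMap.lineMap c q r ∈ convexHull ℝ (s : Set E) := by
    by_contra! hev
    obtain ⟨r, ⟨s, hs, hr⟩, hr'⟩ := (hmem.and ((Filter.eventually_all_finite hfin).2 hev)).exists
    exact hr' s hs hr
  have hlim : Filter.Tendsto (AffineMap.lineMap c q : ℝ → E) (𝓝[>] 0) (𝓝 c) := by
    have := (AffineMap.lineMap_continuous (R := ℝ) (p := c) (q := q)).tendsto 0
    rw [AffineMap.lineMap_apply_zero] at this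
    exact tendsto_nhdsWithin_of_tendsto_nhds this
  obtain ⟨r, hr, hr0⟩ := (hfreq.and_eventually self_mem_nhdsWithin).exists
  exact ⟨s, hs, (s.finite_toSet.isClosed_convexHull ℝ).mem_of_frequently_of_tendsto hfreq hlim,
    r, hr0, hr⟩

theorem IsGeneric.exists_spanningFace_lineMap_mem (hq : IsGeneric K q) (hfin : K.faces.Finite)
    (hK : Convex ℝ K.space) (hc : c ∈ K.space) :
    ∃ s ∈ spanningFaces K, c ∈ convexHull ℝ (s : Set E) ∧
      ∃ r : ℝ, 0 < r ∧ AffineMap.lineMap c q r ∈ convexHull ℝ (s : Set E) := by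
  obtain ⟨s, hs, hcs, r, hr, hrs⟩ := exists_face_lineMap_mem hfin hK hc hq.1
  exact ⟨s, hq.2 s hs (mem_of_lineMap_mem hr.ne' (convexHull_subset_affineSpan _ hcs)
    (convexHull_subset_affineSpan _ hrs)), hcs, r, hr, hrs⟩

theorem exists_spanningFace_mem (hfin : K.faces.Finite) (hK : Convex ℝ K.space)
    (hp : p ∈ K.space) : ∃ s ∈ spanningFaces K, p ∈ convexHull ℝ (s : Set E) := by
  obtain ⟨q, hq⟩ := exists_isGeneric hfin hK ⟨p, hp⟩
  obtain ⟨s, hs, hps, -⟩ := hq.exists_spanningFace_lineMap_mem hfin hK hp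
  exact ⟨s, hs, hps⟩

theorem IsGeneric.existsUnique_visible_eq_empty (hq : IsGeneric K q) (hfin : K.faces.Finite)
    (hK : Convex ℝ K.space) : ∃! s, s ∈ spanningFaces K ∧ visible q s = ∅ := by
  obtain ⟨s, hs, hqs⟩ := exists_spanningFace_mem hfin hK hq.1
  have hsv : visible q s = ∅ :=
    Finset.filter_false_of_mem fun x hx => not_lt.2 (baryCoord_nonneg (K.indep hs.1) hx hqs)
  refine ⟨s, ⟨hs, hsv⟩, fun t ⟨ht, htv⟩ => ?_⟩
  exact eq_of_baryCoord_pos ht.1 hs.1 (ht.2 hq.1) (hs.2 hq.1)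
    (fun x hx => hq.baryCoord_pos ht hx (htv ▸ Finset.notMem_empty x))
    (fun x hx => hq.baryCoord_pos hs hx (hsv ▸ Finset.notMem_empty x))

theorem IsGeneric.exists_visible_subset (hq : IsGeneric K q) (hfin : K.faces.Finite)
    (hK : Convex ℝ K.space) (hQ : Q ∈ K.faces) :
    ∃ s ∈ spanningFaces K, visible q s ⊆ Q ∧ Q ⊆ s := by
  have hcQ := Q.centroid_mem_convexHull (R := ℝ) (K.nonempty_of_mem_faces hQ)
  obtain ⟨s, hs, hcs, r, hr, hrs⟩ := hq.exists_spanningFace_lineMap_mem hfin hK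
    (K.convexHull_subset_space hQ hcQ)
  have hQs := subset_of_centroid_mem hQ hs.1 hcs
  refine ⟨s, hs, fun x hx => ?_, hQs⟩
  obtain ⟨hxs, hxq⟩ := Finset.mem_filter.1 hx
  by_contra hxQ
  have hr' := baryCoord_nonneg (K.indep hs.1) hxs hrs
  rw [AffineMap.apply_lineMap, AffineMap.lineMap_apply_ring', baryCoord_eq_zero (K.indep hs.1) hxs
    hQs hxQ (convexHull_subset_affineSpan _ hcQ), sub_zero, add_zero] at hr'
  exact hr'.not_gt (mul_neg_of_pos_of_neg hr hxq)

theorem IsGeneric.eventually_baryCoord_pos (hq : IsGeneric K q) (hs : s ∈ spanningFaces K)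
    (hQ : Q.Nonempty) (hvQ : visible q s ⊆ Q) (hQs : Q ⊆ s) : ∀ᶠ r : ℝ in 𝓝[>] 0,
      ∀ x ∈ s, 0 < baryCoord s x (AffineMap.lineMap (Q.centroid ℝ id) q r) := by
  rw [Filter.eventually_all_finset]
  intro x hx
  simp only [AffineMap.apply_lineMap]
  by_cases hxQ : x ∈ Q
  · have hlim := (AffineMap.lineMap_continuous (R := ℝ)
      (p := baryCoord s x (Q.centroid ℝ id)) (q := baryCoord s x q)).tendsto 0
    rw [AffineMap.lineMap_apply_zero] at hlim
    exact (tendsto_nhdsWithin_of_tendsto_nhds hlim).eventually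
      (lt_mem_nhds (baryCoord_centroid_pos (K.indep hs.1) hx hQs hxQ))
  · filter_upwards [self_mem_nhdsWithin] with r hr
    have hcQ := convexHull_subset_affineSpan _ (Q.centroid_mem_convexHull (R := ℝ) hQ)
    rw [baryCoord_eq_zero (K.indep hs.1) hx hQs hxQ hcQ, AffineMap.lineMap_apply_ring', sub_zero,
      add_zero]
    exact mul_pos hr (hq.baryCoord_pos hs hx fun h => hxQ (hvQ h))

theorem IsGeneric.existsUnique_visible_subset (hq : IsGeneric K q) (hfin : K.faces.Finite)
    (hK : Convex ℝ K.space) (hQ : Q ∈ K.faces) :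
    ∃! s, s ∈ spanningFaces K ∧ visible q s ⊆ Q ∧ Q ⊆ s := by
  obtain ⟨s, hs, hvQ, hQs⟩ := hq.exists_visible_subset hfin hK hQ
  refine ⟨s, ⟨hs, hvQ, hQs⟩, fun t ⟨ht, hvQt, hQt⟩ => ?_⟩
  have hne := K.nonempty_of_mem_faces hQ
  have hc : Q.centroid ℝ id ∈ K.space :=
    K.convexHull_subset_space hQ (Q.centroid_mem_convexHull hne)
  obtain ⟨r, hrt, hrs⟩ := ((hq.eventually_baryCoord_pos ht hne hvQt hQt).and
    (hq.eventually_baryCoord_pos hs hne hvQ hQs)).exists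
  exact eq_of_baryCoord_pos ht.1 hs.1 (AffineMap.lineMap_mem r (ht.2 hc) (ht.2 hq.1))
    (AffineMap.lineMap_mem r (hs.2 hc) (hs.2 hq.1)) hrt hrs

end Normed

end HalfOpenDecomposition

section Counting

variable {α : Type*}

/-- The number of points in the relative interior of a simplex with `k` vertices whose barycentric
coordinates are multiples of `1 / (N + 1)`; the empty simplex has none. -/
def interiorSimplexNumber (N : ℕ) : ℕ → ℕ
  | 0 => 0
  | k + 1 => N.choose k

theorem interiorSimplexNumber_succ_succ (N k : ℕ) : interiorSimplexNumber (N + 1) (k + 1) =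
    interiorSimplexNumber N k + interiorSimplexNumber N (k + 1) := by
  cases k with
  | zero => simp [interiorSimplexNumber]
  | succ k => exact Nat.choose_succ_succ N k

theorem sum_powerset_interiorSimplexNumber (t : Finset α) (N i : ℕ) :
    ∑ u ∈ t.powerset, interiorSimplexNumber N (u.card + i) =
      interiorSimplexNumber (N + t.card) (i + t.card) := by
  classical
  induction t using Finset.induction_on generalizing N i with
  | empty => simp
  | insert a t ha ih =>
    have hcard : ∀ u ∈ t.powerset, (insert a u).card = u.card + 1 := fun u hu =>
      Finset.card_insert_of_notMem fun hm => ha (Finset.mem_powerset.1 hu hm)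
    calc ∑ u ∈ (insert a t).powerset, interiorSimplexNumber N (u.card + i)
        = ∑ u ∈ t.powerset, interiorSimplexNumber N (u.card + i) +
            ∑ u ∈ t.powerset, interiorSimplexNumber N ((insert a u).card + i) :=
          Finset.sum_powerset_insert ha _
      _ = ∑ u ∈ t.powerset, interiorSimplexNumber (N + 1) (u.card + (i + 1)) := by
          rw [← Finset.sum_add_distrib]
          refine Finset.sum_congr rfl fun u hu => ?_
          rw [hcard u hu, add_right_comm, ← add_assoc, interiorSimplexNumber_succ_succ]
      _ = interiorSimplexNumber (N + (insert a t).card) (i + (insert a t).card) := by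
          rw [ih, Finset.card_insert_of_notMem ha]
          congr 1 <;> ring

theorem sum_Icc_interiorSimplexNumber [DecidableEq α] {r s : Finset α} (h : r ⊆ s) (N : ℕ) :
    ∑ u ∈ Finset.Icc r s, interiorSimplexNumber N u.card =
      interiorSimplexNumber (N + (s.card - r.card)) s.card := by
  have hshift : ∑ u ∈ Finset.Icc r s, interiorSimplexNumber N u.card =
      ∑ u ∈ (s \ r).powerset, interiorSimplexNumber N (u.card + r.card) := by
    refine Finset.sum_nbij' (· \ r) (· ∪ r) ?_ ?_ ?_ ?_ ?_ <;>
      simp only [Finset.mem_Icc, Finset.mem_powerset, Finset.subset_sdiff,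
        and_imp]
    · exact fun u _ hus => ⟨Finset.sdiff_subset.trans hus, Finset.sdiff_disjoint⟩
    · exact fun u hus _ => ⟨Finset.subset_union_right, Finset.union_subset hus h⟩
    · exact fun u hru _ => Finset.sdiff_union_of_subset hru
    · exact fun u _ hur => Finset.union_sdiff_cancel_right hur
    · exact fun u hru _ => by rw [Finset.card_sdiff_add_card_eq_card hru]
  rw [hshift, sum_powerset_interiorSimplexNumber, Finset.card_sdiff_of_subset h,
    Nat.add_sub_cancel' (Finset.card_le_card h)]

/-- The number of points with barycentric coordinates in `1 / (N + 1)` times the integers that lie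
in the relative interiors of the simplices with vertex sets in `S`. -/
noncomputable def simplexSum (S : Set (Finset α)) (N : ℕ) : ℤ :=
  ∑ᶠ s ∈ S, (interiorSimplexNumber N s.card : ℤ)

variable {K : PreAbstractSimplicialComplex α} {v : α}

theorem faces_eq_union_insert_of_cone [DecidableEq α] (hv : {v} ∈ K.faces)
    (hcone : ∀ s ∈ K.faces, insert v s ∈ K.faces) :
    K.faces = {s ∈ K.faces | v ∉ s} ∪ insert {v} (insert v '' {s ∈ K.faces | v ∉ s}) := by
  ext s
  constructor
  · intro hs
    by_cases hvs : v ∈ s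
    · rcases (s.erase v).eq_empty_or_nonempty with h | h
      · exact Or.inr (Or.inl (by rw [← Finset.insert_erase hvs, h, insert_empty_eq]))
      · exact Or.inr (Or.inr ⟨s.erase v, ⟨(K.isRelLowerSet_faces hs).2 (s.erase_subset v) h,
          s.notMem_erase v⟩, Finset.insert_erase hvs⟩)
    · exact Or.inl ⟨hs, hvs⟩
  · rintro (hs | rfl | ⟨s, hs, rfl⟩)
    exacts [hs.1, hv, hcone s hs.1]

theorem simplexSum_eq_one_add [DecidableEq α] (hfin : K.faces.Finite) (hv : {v} ∈ K.faces)
    (hcone : ∀ s ∈ K.faces, insert v s ∈ K.faces) (N : ℕ) :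
    simplexSum K.faces N =
      1 + ∑ᶠ s ∈ {s ∈ K.faces | v ∉ s}, (interiorSimplexNumber (N + 1) (s.card + 1) : ℤ) := by
  have hfaces := faces_eq_union_insert_of_cone hv hcone
  set S := {s ∈ K.faces | v ∉ s}
  have hS : S.Finite := hfin.subset (Set.sep_subset _ _)
  have hinj : Set.InjOn (insert v) S := fun s hs t ht h => by
    rw [← Finset.erase_insert hs.2, h, Finset.erase_insert ht.2]
  have hdisj : Disjoint S (insert {v} (insert v '' S)) := by
    refine Set.disjoint_left.2 fun s hs h => hs.2 ?_
    rcases h with rfl | ⟨s, -, rfl⟩ <;> simp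
  have hvS : {v} ∉ insert v '' S := by
    rintro ⟨s, hs, h⟩
    obtain ⟨x, hx⟩ := (K.isRelLowerSet_faces hs.1).1
    have hxv : x ∈ ({v} : Finset α) := h ▸ Finset.mem_insert_of_mem hx
    exact hs.2 (Finset.mem_singleton.1 hxv ▸ hx)
  rw [simplexSum, hfaces, finsum_mem_union hdisj hS ((hS.image _).insert _),
    finsum_mem_insert _ hvS (hS.image _), finsum_mem_image hinj, add_left_comm,
    ← finsum_mem_add_distrib hS]
  congr 1
  · simp [interiorSimplexNumber]
  · refine finsum_mem_congr rfl fun s hs => ?_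
    rw [Finset.card_insert_of_notMem hs.2, interiorSimplexNumber_succ_succ, Nat.cast_add]

theorem simplexSum_zero_of_cone [DecidableEq α] (hfin : K.faces.Finite) (hv : {v} ∈ K.faces)
    (hcone : ∀ s ∈ K.faces, insert v s ∈ K.faces) :
    simplexSum K.faces 0 = 1 + simplexSum {s ∈ K.faces | v ∉ s} 0 := by
  rw [simplexSum_eq_one_add hfin hv hcone]
  refine congrArg _ (finsum_mem_congr rfl fun s hs => ?_)
  obtain ⟨k, hk⟩ := Nat.exists_eq_succ_of_ne_zero (K.isRelLowerSet_faces hs.1).1.card_ne_zero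
  simp [hk, interiorSimplexNumber, Nat.choose_succ_succ]

theorem simplexSum_succ_of_cone [DecidableEq α] (hfin : K.faces.Finite) (hv : {v} ∈ K.faces)
    (hcone : ∀ s ∈ K.faces, insert v s ∈ K.faces) (N : ℕ) :
    simplexSum K.faces (N + 1) =
      simplexSum K.faces N + simplexSum {s ∈ K.faces | v ∉ s} (N + 1) := by
  have hS : {s ∈ K.faces | v ∉ s}.Finite := hfin.subset (Set.sep_subset _ _)
  rw [simplexSum_eq_one_add hfin hv hcone, simplexSum_eq_one_add hfin hv hcone N, simplexSum,
    add_assoc (1 : ℤ), ← finsum_mem_add_distrib hS]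
  refine congrArg _ (finsum_mem_congr rfl fun s _ => ?_)
  rw [interiorSimplexNumber_succ_succ, Nat.cast_add, add_comm]

end Counting

section

open Geometry

variable {E : Type*} [NormedAddCommGroup E] [NormedSpace ℝ E] {K : SimplicialComplex ℝ E} {q : E}

theorem IsGeneric.simplexSum_faces (hq : IsGeneric K q) (hfin : K.faces.Finite)
    (hK : Convex ℝ K.space) (N : ℕ) :
    simplexSum K.faces N = ∑ᶠ s ∈ spanningFaces K,
      (interiorSimplexNumber (N + (s.card - (visible q s).card)) s.card : ℤ) := by
  classical
  have hunion : K.faces = ⋃ s ∈ spanningFaces K, {Q ∈ K.faces | visible q s ⊆ Q ∧ Q ⊆ s} := by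
    refine Set.Subset.antisymm (fun Q hQ => ?_) (Set.iUnion₂_subset fun s _ => Set.sep_subset _ _)
    obtain ⟨s, ⟨hs, h⟩, -⟩ := hq.existsUnique_visible_subset hfin hK hQ
    exact Set.mem_biUnion hs ⟨hQ, h⟩
  have hdisj : (spanningFaces K).PairwiseDisjoint
      fun s => {Q ∈ K.faces | visible q s ⊆ Q ∧ Q ⊆ s} := fun s hs t ht hst =>
    Set.disjoint_left.2 fun Q hQs hQt => hst
      ((hq.existsUnique_visible_subset hfin hK hQs.1).unique ⟨hs, hQs.2⟩ ⟨ht, hQt.2⟩)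
  rw [simplexSum]
  conv_lhs => rw [hunion]
  rw [finsum_mem_biUnion hdisj (hfin.subset (Set.sep_subset _ _))
    fun s _ => hfin.subset (Set.sep_subset _ _)]
  refine finsum_mem_congr rfl fun s hs => ?_
  rw [← sum_Icc_interiorSimplexNumber visible_subset, Nat.cast_sum]
  refine finsum_mem_eq_sum_of_inter_support_eq _ ?_
  ext Q
  simp only [Set.mem_inter_iff, Set.mem_ofPred_eq, Finset.coe_Icc, Set.mem_Icc,
    and_congr_left_iff, and_iff_right_iff_imp]
  intro hQ0 hQ
  refine K.down_closed hs.1 hQ.2 (Finset.nonempty_iff_ne_empty.2 ?_)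
  rintro rfl
  simp [interiorSimplexNumber] at hQ0

end

section Faces

variable {E : Type*} [NormedAddCommGroup E] [NormedSpace ℝ E] {P F G : Set E} {x y z v : E}

theorem IsFace.exists_eq (hF : IsFace P F) (hne : F.Nonempty) :
    ∃ (l : E →L[ℝ] ℝ) (M : ℝ), (∀ x ∈ P, l x ≤ M) ∧ F = {x ∈ P | l x = M} := by
  obtain ⟨l, rfl⟩ := hF hne
  obtain ⟨x₀, hx₀, hmax⟩ := hne
  exact ⟨l, l x₀, hmax, Set.ext fun x => and_congr_right fun hx =>
    ⟨fun h => le_antisymm (hmax x hx) (h x₀ hx₀), fun h y hy => h ▸ hmax y hy⟩⟩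

theorem isFace_setOf_eq {l : E →L[ℝ] ℝ} {M : ℝ} (h : ∀ x ∈ P, l x ≤ M) :
    IsFace P {x ∈ P | l x = M} := by
  rintro ⟨x₀, hx₀, rfl⟩
  exact ⟨l, Set.ext fun x => and_congr_right fun hx =>
    ⟨fun he y hy => he ▸ h y hy, fun hle => le_antisymm (h x hx) (hle x₀ hx₀)⟩⟩

theorem self_mem_faces (hne : P.Nonempty) : P ∈ faces P := ⟨IsExposed.refl P, hne⟩

theorem mem_of_mem_vert (hx : x ∈ vert P) : x ∈ P := hx.subset rfl

theorem IsFace.convexHull_inter_subset (hF : IsFace P F) (hP : Convex ℝ P) {s : Set E}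
    (hs : s ⊆ P) : convexHull ℝ s ∩ F ⊆ convexHull ℝ (s ∩ F) := by
  rintro x ⟨hx, hxF⟩
  have hconv : Convex ℝ {y ∈ P | y ∈ F → y ∈ convexHull ℝ (s ∩ F)} := by
    refine convex_iff_openSegment_subset.2 fun y hy z hz w hw => ⟨?_, fun hwF => ?_⟩
    · exact hP.openSegment_subset hy.1 hz.1 hw
    · exact (convex_convexHull ℝ _).openSegment_subset
        (hy.2 (hF.isExtreme.left_mem_of_mem_openSegment hy.1 hz.1 hwF hw))
        (hz.2 (hF.isExtreme.right_mem_of_mem_openSegment hy.1 hz.1 hwF hw)) hw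
  have hsub : s ⊆ {y ∈ P | y ∈ F → y ∈ convexHull ℝ (s ∩ F)} := fun y hy =>
    ⟨hs hy, fun hyF => subset_convexHull ℝ _ ⟨hy, hyF⟩⟩
  exact (convexHull_min hsub hconv hx).2 hxF

theorem IsFace.eq_convexHull_inter {A : Set E} (hF : IsFace (convexHull ℝ A) F) :
    F = convexHull ℝ (A ∩ F) :=
  Set.Subset.antisymm
    (fun _ hx => hF.convexHull_inter_subset (convex_convexHull ℝ A) (subset_convexHull ℝ A)
      ⟨hF.subset hx, hx⟩)
    (convexHull_min Set.inter_subset_right (IsExposed.convex hF (convex_convexHull ℝ A)))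

theorem isFace_convexHull_setOf_eq {A : Set E} {l : E →L[ℝ] ℝ} {M : ℝ} (h : ∀ a ∈ A, l a ≤ M) :
    IsFace (convexHull ℝ A) (convexHull ℝ {a ∈ A | l a = M}) := by
  have hface : IsFace (convexHull ℝ A) {x ∈ convexHull ℝ A | l x = M} :=
    isFace_setOf_eq fun x hx => convexHull_min (t := {x | l x ≤ M}) h
      (convex_halfSpace_le l.toLinearMap.isLinear M) hx
  have hA : A ∩ {x ∈ convexHull ℝ A | l x = M} = {a ∈ A | l a = M} :=
    Set.ext fun a => ⟨fun ha => ⟨ha.1, ha.2.2⟩, fun ha => ⟨ha.1, subset_convexHull ℝ A ha.1, ha.2⟩⟩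
  rw [← hA, ← hface.eq_convexHull_inter]
  exact hface

theorem vert_convexHull_subset (A : Set E) : vert (convexHull ℝ A) ⊆ A := fun _ hx =>
  extremePoints_convexHull_subset
    (exposedPoints_subset_extremePoints (mem_exposedPoints_iff_exposed_singleton.2 hx))

theorem IsPolytope.convex (hP : IsPolytope P) : Convex ℝ P := by
  obtain ⟨A, rfl⟩ := hP
  exact convex_convexHull ℝ _

theorem IsPolytope.of_isFace (hP : IsPolytope P) (hF : IsFace P F) : IsPolytope F := by
  classical
  obtain ⟨A, rfl⟩ := hP
  refine ⟨A.filter (· ∈ F), ?_⟩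
  rw [Finset.coe_filter]
  exact hF.eq_convexHull_inter

theorem IsPolytope.finite_faces (hP : IsPolytope P) : (faces P).Finite := by
  obtain ⟨A, rfl⟩ := hP
  refine (A.finite_toSet.finite_subsets.image (convexHull ℝ)).subset fun F hF => ?_
  exact ⟨A ∩ F, Set.inter_subset_left, hF.1.eq_convexHull_inter.symm⟩

theorem exists_forall_lt_mul {ι : Type*} (A : Finset ι) (f g : ι → ℝ) :
    ∃ r : ℝ, ∀ a ∈ A, 0 < g a → f a < r * g a := by
  obtain ⟨r, hr⟩ := (A.image fun a => f a / g a).exists_le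
  exact ⟨r + 1, fun a ha hga => (div_lt_iff₀ hga).1
    ((hr _ (Finset.mem_image_of_mem _ ha)).trans_lt (lt_add_one r))⟩

theorem IsPolytope.isFace_trans (hP : IsPolytope P) (hF : IsFace P F) (hG : IsFace F G) :
    IsFace P G := by
  rcases G.eq_empty_or_nonempty with rfl | hGne
  · exact isExposed_empty
  have hGF : G ⊆ F := hG.subset
  obtain ⟨l, M, hM, hFl⟩ := hF.exists_eq (hGne.mono hGF)
  obtain ⟨m, N, hN, hGm⟩ := hG.exists_eq hGne
  obtain ⟨A, rfl⟩ := hP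
  have hA : ∀ a ∈ A, l a ≤ M := fun a ha => hM a (subset_convexHull ℝ _ ha)
  have hAF : ∀ a ∈ A, a ∈ F ↔ l a = M := fun a ha => by
    rw [hFl]; exact and_iff_right (subset_convexHull ℝ _ ha)
  have hAG : ∀ a ∈ A, a ∈ G ↔ l a = M ∧ m a = N := fun a ha => by
    rw [hGm, ← hAF a ha]; rfl
  -- Maximise `l` first and `m` second by weighting `l` heavily.
  obtain ⟨r, hr⟩ := exists_forall_lt_mul A (fun a => m a - N) fun a => M - l a
  have hlt : ∀ a ∈ A, a ∉ F → (r • l + m) a < r * M + N := fun a ha haF => by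
    have := hr a ha (sub_pos.2 (lt_of_le_of_ne (hA a ha) (mt (hAF a ha).2 haF)))
    simp only [add_apply, smul_apply, smul_eq_mul]
    linarith
  have hle : ∀ a ∈ A, (r • l + m) a ≤ r * M + N := fun a ha => by
    by_cases haF : a ∈ F
    · simpa [(hAF a ha).1 haF] using hN a haF
    · exact (hlt a ha haF).le
  have hiff : ∀ a ∈ A, (r • l + m) a = r * M + N ↔ a ∈ G := fun a ha => by
    rw [hAG a ha]
    refine ⟨fun h => ?_, fun h => by simp [h.1, h.2]⟩
    have hla : l a = M := (hAF a ha).1 (not_imp_comm.1 (hlt a ha) h.not_lt)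
    exact ⟨hla, by simpa [hla] using h⟩
  have hface := isFace_convexHull_setOf_eq (A := (A : Set E)) hle
  rw [hF.eq_convexHull_inter] at hG
  rwa [Set.sep_ext_iff.2 hiff, ← Set.inter_def, ← Set.inter_eq_right.2 hGF, ← Set.inter_assoc,
    ← hG.eq_convexHull_inter] at hface

end Faces

section SimplexFaces

open Geometry

variable {E : Type*} [NormedAddCommGroup E] [NormedSpace ℝ E] [FiniteDimensional ℝ E]
  {P : Set E} {C : Set (Set E)} {s t : Finset E}

theorem isFace_convexHull_erase [DecidableEq E] (hs : AffineIndependent ℝ ((↑) : s → E)) (x : E) :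
    IsFace (convexHull ℝ (s : Set E)) (convexHull ℝ (s.erase x : Set E)) := by
  by_cases hx : x ∈ s
  · set f := baryCoord s x
    set l : E →L[ℝ] ℝ := -f.linear.toContinuousLinearMap
    have hl : ∀ a, l a = f 0 - f a := fun a => by
      have := f.linearMap_vsub a 0
      rw [vsub_eq_sub, sub_zero, vsub_eq_sub] at this
      exact (congrArg Neg.neg this).trans (neg_sub _ _)
    have hx1 : f x = 1 := baryCoord_self hs hx
    have h0 : ∀ a ∈ s, a ≠ x → f a = 0 := fun a ha => baryCoord_of_ne hs hx ha
    have hle : ∀ a ∈ s, l a ≤ f 0 := fun a ha => by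
      rw [hl, sub_le_self_iff]
      exact baryCoord_nonneg hs hx (subset_convexHull ℝ _ ha)
    have hiff : ∀ a ∈ s, l a = f 0 ↔ a ≠ x := fun a ha => by
      rw [hl, sub_eq_self]
      exact ⟨by rintro h rfl; exact one_ne_zero (hx1.symm.trans h), h0 a ha⟩
    have hface := isFace_convexHull_setOf_eq (A := (s : Set E)) hle
    rw [Set.sep_ext_iff.2 hiff] at hface
    rwa [Finset.coe_erase]
  · rw [Finset.erase_eq_of_notMem hx]
    exact IsExposed.refl _

theorem isFace_convexHull_of_subset (hs : AffineIndependent ℝ ((↑) : s → E)) (hts : t ⊆ s) :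
    IsFace (convexHull ℝ (s : Set E)) (convexHull ℝ (t : Set E)) := by
  classical
  induction s using Finset.strongInduction with
  | H s ih =>
    rcases hts.eq_or_ssubset with rfl | hssub
    · exact IsExposed.refl _
    · obtain ⟨x, hx, hxt⟩ := Finset.exists_of_ssubset hssub
      exact IsPolytope.isFace_trans ⟨s, rfl⟩ (isFace_convexHull_erase hs x)
        (ih _ (Finset.erase_ssubset hx) (hs.mono (Finset.erase_subset x s))
          (Finset.subset_erase.2 ⟨hts, hxt⟩))

theorem subset_of_convexHull_eq (hs : AffineIndependent ℝ ((↑) : s → E))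
    (h : convexHull ℝ (s : Set E) = convexHull ℝ (t : Set E)) : s ⊆ t := fun x hx => by
  have hface := isFace_convexHull_of_subset hs (Finset.singleton_subset_iff.2 hx)
  rw [h, Finset.coe_singleton, convexHull_singleton] at hface
  exact vert_convexHull_subset _ hface

theorem eq_of_convexHull_eq (hs : AffineIndependent ℝ ((↑) : s → E))
    (ht : AffineIndependent ℝ ((↑) : t → E))
    (h : convexHull ℝ (s : Set E) = convexHull ℝ (t : Set E)) : s = t :=
  Finset.Subset.antisymm (subset_of_convexHull_eq hs h) (subset_of_convexHull_eq ht h.symm)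

theorem convexHull_inter_subset_of_isFace (hs : AffineIndependent ℝ ((↑) : s → E))
    (ht : AffineIndependent ℝ ((↑) : t → E))
    (hst : IsFace (convexHull ℝ (s : Set E)) (convexHull ℝ (s : Set E) ∩ convexHull ℝ (t : Set E)))
    (hts : IsFace (convexHull ℝ (t : Set E))
      (convexHull ℝ (s : Set E) ∩ convexHull ℝ (t : Set E))) :
    convexHull ℝ (s : Set E) ∩ convexHull ℝ (t : Set E) ⊆ convexHull ℝ (s ∩ t : Set E) := by
  classical
  set I := convexHull ℝ (s : Set E) ∩ convexHull ℝ (t : Set E)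
  have hsI := hst.eq_convexHull_inter
  have htI := hts.eq_convexHull_inter
  have hfilter : s.filter (· ∈ I) = t.filter (· ∈ I) :=
    eq_of_convexHull_eq (hs.mono (Finset.filter_subset _ s)) (ht.mono (Finset.filter_subset _ t))
      (by rw [Finset.coe_filter, Finset.coe_filter]; exact hsI.symm.trans htI)
  rw [hsI]
  refine convexHull_mono fun x hx => ⟨hx.1, ?_⟩
  have hxt : x ∈ t.filter (· ∈ I) := hfilter ▸ Finset.mem_filter.2 hx
  exact (Finset.mem_filter.1 hxt).1

/-- The simplicial complex of the vertex sets of the nonempty simplices of a triangulation. -/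
def IsTriangulation.simplicialComplex (hC : IsTriangulation P C) : SimplicialComplex ℝ E where
  faces := {s | s.Nonempty ∧ AffineIndependent ℝ ((↑) : s → E) ∧ convexHull ℝ (s : Set E) ∈ C}
  isRelLowerSet_faces _ hs := ⟨hs.1, fun _ hts hne => ⟨hne, hs.2.1.mono hts,
    hC.complex.face_mem _ hs.2.2 _ (isFace_convexHull_of_subset hs.2.1 hts)⟩⟩
  indep hs := hs.2.1
  inter_subset_convexHull hs ht :=
    have hinter := hC.complex.inter_face _ hs.2.2 _ ht.2.2
    convexHull_inter_subset_of_isFace hs.2.1 ht.2.1 hinter.1 hinter.2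

theorem IsTriangulation.finite_faces (hC : IsTriangulation P C) :
    hC.simplicialComplex.faces.Finite :=
  Set.Finite.of_finite_image (f := fun s : Finset E => convexHull ℝ (s : Set E))
    (hC.complex.finite.subset (Set.image_subset_iff.2 fun _ hs => hs.2.2))
    fun _ hs _ ht h => eq_of_convexHull_eq hs.2.1 ht.2.1 h

theorem IsTriangulation.space_eq (hC : IsTriangulation P C) : hC.simplicialComplex.space = P := by
  refine Eq.trans (Set.Subset.antisymm
    (Set.iUnion₂_subset fun s hs => Set.subset_sUnion_of_mem hs.2.2) ?_) hC.sUnion_eq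
  rintro x ⟨Q, hQ, hx⟩
  obtain ⟨s, hs, rfl⟩ := hC.simplex Q hQ
  have hne : s.Nonempty := Finset.coe_nonempty.1 (convexHull_nonempty_iff.1 ⟨x, hx⟩)
  exact Set.mem_biUnion (show s ∈ hC.simplicialComplex.faces from ⟨hne, hs, hQ⟩) hx

end SimplexFaces

section RelativeInterior

variable {E : Type*} [NormedAddCommGroup E] [NormedSpace ℝ E] {G : Set E} {z v : E}

theorem exists_forall_le_of_notMem_interior (hG : Convex ℝ G) (hint : (interior G).Nonempty)
    (hz : z ∉ interior G) :
    ∃ f : E →L[ℝ] ℝ, (∀ x ∈ G, f x ≤ f z) ∧ ∃ x ∈ G, f x < f z := by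
  obtain ⟨f, hf⟩ := geometric_hahn_banach_open_point hG.interior isOpen_interior hz
  refine ⟨f, fun x hx => ?_, hint.imp fun x hx => ⟨interior_subset hx, hf x hx⟩⟩
  have hcl : closure (interior G) ⊆ {x | f x ≤ f z} :=
    closure_minimal (fun x hx => (hf x hx).le) (isClosed_le f.continuous continuous_const)
  rw [hG.closure_interior_eq_closure_of_nonempty_interior hint] at hcl
  exact hcl (subset_closure hx)

variable [FiniteDimensional ℝ E]

theorem nonempty_interior_translate (hG : Convex ℝ G) (hz : z ∈ G) :
    (interior {w : vectorSpan ℝ G | (w : E) + z ∈ G}).Nonempty := by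
  set φ : vectorSpan ℝ G →ᵃ[ℝ] E := (vectorSpan ℝ G).subtype.toAffineMap + AffineMap.const ℝ _ z
  have himage : φ '' (φ ⁻¹' G) = G := by
    refine Set.image_preimage_eq_of_subset fun x hx => ?_
    exact ⟨⟨x -ᵥ z, vsub_mem_vectorSpan ℝ hx hz⟩, sub_add_cancel x z⟩
  have hlinear : φ.linear = (vectorSpan ℝ G).subtype := add_zero _
  have hspan : vectorSpan ℝ (φ ⁻¹' G) = ⊤ := by
    refine Submodule.map_injective_of_injective (vectorSpan ℝ G).subtype_injective ?_
    rw [Submodule.map_subtype_top, ← hlinear, AffineMap.map_vectorSpan, himage]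
  have h0 : (φ ⁻¹' G).Nonempty := ⟨0, by simpa [φ] using hz⟩
  refine (hG.affine_preimage φ).interior_nonempty_iff_affineSpan_eq_top.2 ?_
  exact (AffineSubspace.affineSpan_eq_top_iff_vectorSpan_eq_top_of_nonempty ℝ _ _ h0).2 hspan

theorem zero_mem_interior_of_forall_isFace (hG : Convex ℝ G) (hz : z ∈ G)
    (h : ∀ H, IsFace G H → z ∈ H → H = G) :
    (0 : vectorSpan ℝ G) ∈ interior {w : vectorSpan ℝ G | (w : E) + z ∈ G} := by
  have hconv : Convex ℝ {w : vectorSpan ℝ G | (w : E) + z ∈ G} :=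
    (hG.translate_preimage_left z).linear_preimage (vectorSpan ℝ G).subtype
  by_contra h0
  obtain ⟨f, hle, w, hw, hlt⟩ :=
    exists_forall_le_of_notMem_interior hconv (nonempty_interior_translate hG hz) h0
  obtain ⟨g, hg, -⟩ := exists_extension_norm_eq (vectorSpan ℝ G) f
  have hgz : ∀ x ∈ G, g x ≤ g z := fun x hx => by
    have := hle ⟨x - z, vsub_mem_vectorSpan ℝ hx hz⟩ (by simpa using hx)
    rw [← hg, ← hg] at this
    simpa using this
  have hwG : (w : E) + z ∈ {x ∈ G | g x = g z} := by
    rw [h _ (isFace_setOf_eq hgz) ⟨hz, rfl⟩]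
    exact hw
  refine hlt.ne ?_
  have := hwG.2
  rw [← hg, ← hg]
  simpa using this

theorem exists_lineMap_mem_of_forall_isFace (hG : Convex ℝ G) (hz : z ∈ G) (hv : v ∈ G)
    (h : ∀ H, IsFace G H → z ∈ H → H = G) : ∃ r : ℝ, 1 < r ∧ AffineMap.lineMap v z r ∈ G := by
  set d : vectorSpan ℝ G := ⟨z -ᵥ v, vsub_mem_vectorSpan ℝ hz hv⟩
  have hlim : Filter.Tendsto (fun r : ℝ => (r - 1) • d) (nhds 1) (nhds 0) := by
    have hcont : Continuous fun r : ℝ => (r - 1) • d := by fun_prop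
    simpa using hcont.tendsto 1
  have hnear := hlim.eventually
    (mem_interior_iff_mem_nhds.1 (zero_mem_interior_of_forall_isFace hG hz h))
  obtain ⟨r, hr, hr1⟩ := ((hnear.filter_mono nhdsWithin_le_nhds).and
    (self_mem_nhdsWithin (s := Set.Ioi (1 : ℝ)))).exists
  refine ⟨r, hr1, ?_⟩
  have hline : AffineMap.lineMap v z r = (r - 1) • (z - v) + z := by
    rw [AffineMap.lineMap_apply_module']
    module
  rw [hline]
  exact hr

end RelativeInterior

section InnerFaces

open Geometry

variable {E : Type*} [NormedAddCommGroup E] [NormedSpace ℝ E] {P F G : Set E}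
  {K : SimplicialComplex ℝ E} {s : Finset E}

/-- The subcomplex of the faces of `K` all of whose vertices lie in `F`. -/
def restrictFaces (K : SimplicialComplex ℝ E) (F : Set E) : SimplicialComplex ℝ E where
  faces := {s ∈ K.faces | (s : Set E) ⊆ F}
  isRelLowerSet_faces _ hs := ⟨K.nonempty_of_mem_faces hs.1, fun _ hts hne =>
    ⟨K.down_closed hs.1 hts hne, (Finset.coe_subset.2 hts).trans hs.2⟩⟩
  indep hs := K.indep hs.1
  inter_subset_convexHull hs ht := K.inter_subset_convexHull hs.1 ht.1

theorem space_restrictFaces (hK : Convex ℝ K.space) (hF : IsFace K.space F) :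
    (restrictFaces K F).space = F := by
  classical
  refine Set.Subset.antisymm
    (Set.iUnion₂_subset fun s hs => convexHull_min hs.2 (IsExposed.convex hF hK)) fun p hp => ?_
  obtain ⟨s, hs, hps⟩ := Set.mem_iUnion₂.1 (hF.subset hp)
  have hpF : p ∈ convexHull ℝ (s.filter (· ∈ F) : Set E) := by
    rw [Finset.coe_filter]
    exact hF.convexHull_inter_subset hK (K.subset_space hs) ⟨hps, hp⟩
  have hne : (s.filter (· ∈ F)).Nonempty :=
    Finset.coe_nonempty.1 (convexHull_nonempty_iff.1 ⟨p, hpF⟩)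
  exact Set.mem_biUnion (show s.filter (· ∈ F) ∈ (restrictFaces K F).faces from
    ⟨K.down_closed hs (Finset.filter_subset _ s) hne, fun x hx => (Finset.mem_filter.1 hx).2⟩) hpF

/-- The faces of `K` whose vertices lie in `F` but in no smaller face of `F`; when `K` triangulates
the polytope `F`, these are the faces that meet the relative interior of `F`. -/
def innerFaces (K : SimplicialComplex ℝ E) (F : Set E) : Set (Finset E) :=
  {s ∈ K.faces | (s : Set E) ⊆ F ∧ ∀ G ∈ faces F, (s : Set E) ⊆ G → G = F}

theorem innerFaces_restrictFaces (K : SimplicialComplex ℝ E) (F : Set E) :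
    innerFaces (restrictFaces K F) F = innerFaces K F :=
  Set.ext fun _ => ⟨fun hs => ⟨hs.1.1, hs.2⟩, fun hs => ⟨⟨hs.1, hs.2.1⟩, hs.2⟩⟩

theorem IsPolytope.faces_subset (hP : IsPolytope P) (hF : F ∈ faces P) : faces F ⊆ faces P :=
  fun _ hG => ⟨hP.isFace_trans hF.1 hG.1, hG.2⟩

theorem eq_of_mem_innerFaces (hF : F ∈ faces P) (hG : G ∈ faces P) (hsF : s ∈ innerFaces K F)
    (hsG : s ∈ innerFaces K G) : F = G := by
  have hs : (s : Set E) ⊆ F ∩ G := Set.subset_inter hsF.2.1 hsG.2.1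
  have hface : IsFace P (F ∩ G) := hF.1.inter hG.1
  have hne : (F ∩ G).Nonempty := (Finset.coe_nonempty.2 (K.nonempty_of_mem_faces hsF.1)).mono hs
  have hFG : F ∩ G = F := hsF.2.2 _
    ⟨hface.mono hF.1.subset Set.inter_subset_left, hne⟩ hs
  have hGF : F ∩ G = G := hsG.2.2 _
    ⟨hface.mono hG.1.subset Set.inter_subset_right, hne⟩ hs
  exact hFG.symm.trans hGF

theorem IsPolytope.exists_mem_innerFaces (hP : IsPolytope P) (hs : s ∈ K.faces)
    (hsP : (s : Set E) ⊆ P) : ∃ F ∈ faces P, s ∈ innerFaces K F := by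
  have hne : P.Nonempty := (Finset.coe_nonempty.2 (K.nonempty_of_mem_faces hs)).mono hsP
  obtain ⟨F, ⟨hF, hsF⟩, hmin⟩ :=
    (hP.finite_faces.subset (Set.sep_subset _ fun F => (s : Set E) ⊆ F)).exists_minimal
      ⟨P, self_mem_faces hne, hsP⟩
  refine ⟨F, hF, hs, hsF, fun G hG hsG => ?_⟩
  exact Set.Subset.antisymm hG.1.subset (hmin ⟨hP.faces_subset hF hG, hsG⟩ hG.1.subset)

theorem simplexSum_biUnion_innerFaces (hP : IsPolytope P) (hfin : K.faces.Finite)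
    {𝓕 : Set (Set E)} (h𝓕 : 𝓕 ⊆ faces P) (N : ℕ) :
    simplexSum (⋃ F ∈ 𝓕, innerFaces K F) N = ∑ᶠ F ∈ 𝓕, simplexSum (innerFaces K F) N := by
  have hdisj : 𝓕.PairwiseDisjoint (innerFaces K) := fun F hF G hG hFG =>
    Set.disjoint_left.2 fun s hsF hsG =>
      hFG (eq_of_mem_innerFaces (h𝓕 hF) (h𝓕 hG) hsF hsG)
  exact finsum_mem_biUnion hdisj (hP.finite_faces.subset h𝓕)
    fun F _ => hfin.subset (Set.sep_subset _ _)

theorem subset_of_centroid_mem_face (hP : Convex ℝ P) (hF : IsFace P F)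
    (hs : AffineIndependent ℝ ((↑) : s → E)) (hne : s.Nonempty) (hsP : (s : Set E) ⊆ P)
    (h : s.centroid ℝ id ∈ F) : (s : Set E) ⊆ F := by
  classical
  intro x hx
  by_contra hxF
  have hc : s.centroid ℝ id ∈ convexHull ℝ (s.filter (· ∈ F) : Set E) := by
    rw [Finset.coe_filter]
    exact hF.convexHull_inter_subset hP hsP ⟨s.centroid_mem_convexHull hne, h⟩
  have h0 : baryCoord s x (s.centroid ℝ id) = 0 :=
    baryCoord_eq_zero hs hx (Finset.filter_subset _ s) (fun hm => hxF (Finset.mem_filter.1 hm).2)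
      (convexHull_subset_affineSpan _ hc)
  exact (baryCoord_centroid_pos hs hx subset_rfl hx).ne' h0

end InnerFaces

section ApexTriangulation

open Geometry

variable {E : Type*} [NormedAddCommGroup E] [NormedSpace ℝ E] {P F G : Set E} {v : Set E → E}
  {K : SimplicialComplex ℝ E} {s : Finset E}

/-- A triangulation `K` of a nonempty polytope `P`, given as a simplicial complex, such that every
nonempty face `F` of `P` has a vertex `v F`, its apex, common to all the simplices of `K` in `F`
that have the dimension of `F`. -/
structure IsApexTriangulation (P : Set E) (v : Set E → E) (K : SimplicialComplex ℝ E) : Prop where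
  polytope : IsPolytope P
  nonempty : P.Nonempty
  finite : K.faces.Finite
  space_eq : K.space = P
  apex_mem_vert : ∀ F ∈ faces P, v F ∈ vert F
  apex_mem : ∀ F ∈ faces P, ∀ s ∈ K.faces, (s : Set E) ⊆ F →
    F ⊆ affineSpan ℝ (s : Set E) → v F ∈ s

namespace IsApexTriangulation

theorem convex_space (h : IsApexTriangulation P v K) : Convex ℝ K.space :=
  h.space_eq ▸ h.polytope.convex

theorem subset (h : IsApexTriangulation P v K) (hs : s ∈ K.faces) : (s : Set E) ⊆ P :=
  h.space_eq ▸ K.subset_space hs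

theorem apex_mem_self (h : IsApexTriangulation P v K) : v P ∈ P :=
  mem_of_mem_vert (h.apex_mem_vert P (self_mem_faces h.nonempty))

theorem face (h : IsApexTriangulation P v K) (hF : F ∈ faces P) :
    IsApexTriangulation F v (restrictFaces K F) where
  polytope := h.polytope.of_isFace hF.1
  nonempty := hF.2
  finite := h.finite.subset (Set.sep_subset _ _)
  space_eq := space_restrictFaces h.convex_space (h.space_eq.symm ▸ hF.1)
  apex_mem_vert G hG := h.apex_mem_vert G (h.polytope.faces_subset hF hG)
  apex_mem G hG s hs := h.apex_mem G (h.polytope.faces_subset hF hG) s hs.1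

theorem exists_spanningFace_mem (h : IsApexTriangulation P v K) {p : E} (hp : p ∈ P) :
    ∃ t ∈ spanningFaces K, v P ∈ t ∧ p ∈ convexHull ℝ (t : Set E) := by
  obtain ⟨t, ht, hpt⟩ :=
    PolytopeNumbers.exists_spanningFace_mem h.finite h.convex_space (h.space_eq.symm ▸ hp)
  exact ⟨t, ht, h.apex_mem P (self_mem_faces h.nonempty) t ht.1 (h.subset ht.1)
    (h.space_eq ▸ ht.2), hpt⟩

theorem singleton_apex_mem_faces (h : IsApexTriangulation P v K) : {v P} ∈ K.faces := by
  obtain ⟨t, ht, hvt, -⟩ := h.exists_spanningFace_mem h.apex_mem_self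
  exact K.down_closed ht.1 (Finset.singleton_subset_iff.2 hvt) (Finset.singleton_nonempty _)

theorem insert_apex_mem_faces [DecidableEq E] (h : IsApexTriangulation P v K) (hs : s ∈ K.faces) :
    insert (v P) s ∈ K.faces := by
  have hc : s.centroid ℝ id ∈ P := h.space_eq ▸
    K.convexHull_subset_space hs (s.centroid_mem_convexHull (K.nonempty_of_mem_faces hs))
  obtain ⟨t, ht, hvt, hct⟩ := h.exists_spanningFace_mem hc
  exact K.down_closed ht.1 (Finset.insert_subset hvt (subset_of_centroid_mem hs ht.1 hct))
    (Finset.insert_nonempty _ _)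

theorem simplexSum_faces_eq_add (h : IsApexTriangulation P v K) (N : ℕ) :
    simplexSum K.faces N =
      simplexSum (innerFaces K P) N + ∑ᶠ F ∈ properFaces P, simplexSum (innerFaces K F) N := by
  have hfaces : faces P = insert P (properFaces P) := Set.ext fun F =>
    ⟨fun hF => or_iff_not_imp_left.2 fun hne => ⟨hF, hne⟩,
      fun hF => hF.elim (by rintro rfl; exact self_mem_faces h.nonempty) And.left⟩
  have hK : K.faces = ⋃ F ∈ faces P, innerFaces K F := Set.Subset.antisymm
    (fun s hs => by
      obtain ⟨F, hF, hsF⟩ := h.polytope.exists_mem_innerFaces hs (h.subset hs)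
      exact Set.mem_biUnion hF hsF)
    (Set.iUnion₂_subset fun F _ => Set.sep_subset _ _)
  conv_lhs => rw [hK]
  rw [simplexSum_biUnion_innerFaces h.polytope h.finite subset_rfl, hfaces]
  exact finsum_mem_insert _ (fun hP => hP.2 rfl) (h.polytope.finite_faces.subset fun _ hF => hF.1)

variable [FiniteDimensional ℝ E]

theorem apex_mem_of_mem_innerFaces (h : IsApexTriangulation P v K) (hG : G ∈ faces P)
    (hv : v P ∈ G) (hs : s ∈ innerFaces K G) : v P ∈ s := by
  set z := s.centroid ℝ id
  have hzs := s.centroid_mem_convexHull (R := ℝ) (K.nonempty_of_mem_faces hs.1)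
  have hGconv := (h.polytope.of_isFace hG.1).convex
  have hinner : ∀ H, IsFace G H → z ∈ H → H = G := fun H hH hzH => hs.2.2 H ⟨hH, z, hzH⟩
    (subset_of_centroid_mem_face hGconv hH (K.indep hs.1) (K.nonempty_of_mem_faces hs.1)
      hs.2.1 hzH)
  -- The segment from the apex to the centroid extends a little beyond the centroid within `G`.
  obtain ⟨r, hr, hrG⟩ :=
    exists_lineMap_mem_of_forall_isFace hGconv (convexHull_min hs.2.1 hGconv hzs) hv hinner
  obtain ⟨t, ht, hvt, hrt⟩ := h.exists_spanningFace_mem (hG.1.subset hrG)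
  have hr0 : 0 < r := zero_lt_one.trans hr
  have hzt : z ∈ convexHull ℝ (t : Set E) := by
    have hmem := (convex_convexHull ℝ (t : Set E)).lineMap_mem (subset_convexHull ℝ _ hvt) hrt
      ⟨inv_nonneg.2 hr0.le, inv_le_one_of_one_le₀ hr.le⟩
    rwa [AffineMap.lineMap_lineMap_right, inv_mul_cancel₀ hr0.ne',
      AffineMap.lineMap_apply_one] at hmem
  have hpos : 0 < baryCoord t (v P) z := by
    have hnonneg := baryCoord_nonneg (K.indep ht.1) hvt hrt
    rw [AffineMap.apply_lineMap, baryCoord_self (K.indep ht.1) hvt,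
      AffineMap.lineMap_apply_ring'] at hnonneg
    by_contra! hle
    linarith [mul_nonpos_of_nonneg_of_nonpos hr0.le hle]
  exact mem_of_baryCoord_pos ht.1 hs.1 hzt hzs hvt hpos

theorem simplexSum_setOf_apex_notMem (h : IsApexTriangulation P v K) (N : ℕ) :
    simplexSum {s ∈ K.faces | v P ∉ s} N =
      ∑ᶠ F ∈ properFaces P ∩ {F | v P ∉ F}, simplexSum (innerFaces K F) N := by
  rw [← simplexSum_biUnion_innerFaces h.polytope h.finite fun F hF => hF.1.1]
  congr 1
  ext s
  rw [Set.mem_iUnion₂]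
  constructor
  · rintro ⟨hs, hv⟩
    obtain ⟨F, hF, hsF⟩ := h.polytope.exists_mem_innerFaces hs (h.subset hs)
    have hvF : v P ∉ F := fun hvF => hv (h.apex_mem_of_mem_innerFaces hF hvF hsF)
    exact ⟨F, ⟨⟨hF, fun he => hvF (he ▸ h.apex_mem_self)⟩, hvF⟩, hsF⟩
  · rintro ⟨F, hF, hsF⟩
    exact ⟨hsF.1, fun hv => hF.2 (hsF.2.1 hv)⟩

end IsApexTriangulation

section Recursion

variable [FiniteDimensional ℝ E]

theorem properFaces_eq_empty (hP : dim P = 0) : properFaces P = ∅ :=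
  Set.eq_empty_of_forall_notMem fun _ hF => (dim_lt_of_mem_properFaces hF).not_ge (hP ▸ zero_le)

theorem polytopeNumber_eq_one (v : Set E → E) (hP : dim P = 0) :
    ∀ n, polytopeNumber v P (n + 1) = 1
  | 0 => by rw [polytopeNumber]
  | n + 1 => by rw [polytopeNumber, if_pos hP]

theorem polytopeNumber_add_two (v : Set E → E) (P : Set E) (n : ℕ) :
    polytopeNumber v P (n + 2) = polytopeNumber v P (n + 1) +
      ∑ᶠ F ∈ properFaces P ∩ {F | v P ∉ F}, interiorPolytopeNumber v F (n + 2) := by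
  by_cases hP : dim P = 0
  · rw [polytopeNumber_eq_one v hP, polytopeNumber_eq_one v hP, properFaces_eq_empty hP,
      Set.empty_inter, finsum_mem_empty, add_zero]
  · rw [polytopeNumber, if_neg hP]

theorem interiorPolytopeNumber_add_two (v : Set E → E) (P : Set E) (n : ℕ) :
    interiorPolytopeNumber v P (n + 2) = polytopeNumber v P (n + 2) -
      ∑ᶠ F ∈ properFaces P, interiorPolytopeNumber v F (n + 2) := by
  by_cases hP : dim P = 0
  · rw [interiorPolytopeNumber, if_pos hP, polytopeNumber_eq_one v hP, properFaces_eq_empty hP,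
      finsum_mem_empty, sub_zero]
  · rw [interiorPolytopeNumber, if_neg hP]

theorem IsApexTriangulation.polytopeNumber_eq_of_properFaces (h : IsApexTriangulation P v K)
    (hF : ∀ F ∈ properFaces P, ∀ N,
      interiorPolytopeNumber v F (N + 2) = simplexSum (innerFaces K F) N) (N : ℕ) :
    polytopeNumber v P (N + 2) = simplexSum K.faces N := by
  classical
  have hcone : ∀ s ∈ K.faces, insert (v P) s ∈ K.faces := fun s hs => h.insert_apex_mem_faces hs
  have hsum : ∀ N, ∑ᶠ F ∈ properFaces P ∩ {F | v P ∉ F}, interiorPolytopeNumber v F (N + 2) =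
      simplexSum {s ∈ K.faces | v P ∉ s} N := fun N =>
    (finsum_mem_congr rfl fun F hF' => hF F hF'.1 N).trans (h.simplexSum_setOf_apex_notMem N).symm
  induction N with
  | zero =>
    rw [polytopeNumber_add_two, hsum, polytopeNumber]
    exact (simplexSum_zero_of_cone h.finite h.singleton_apex_mem_faces hcone).symm
  | succ N ih =>
    rw [polytopeNumber_add_two, hsum, ih]
    exact (simplexSum_succ_of_cone h.finite h.singleton_apex_mem_faces hcone N).symm

theorem IsApexTriangulation.interiorPolytopeNumber_eq (h : IsApexTriangulation P v K) (N : ℕ) :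
    interiorPolytopeNumber v P (N + 2) = simplexSum (innerFaces K P) N := by
  induction hn : dim P using Nat.strong_induction_on generalizing P K N with
  | h n ih =>
    have hface : ∀ F ∈ properFaces P, ∀ N,
        interiorPolytopeNumber v F (N + 2) = simplexSum (innerFaces K F) N := fun F hF N => by
      rw [ih _ (hn ▸ dim_lt_of_mem_properFaces hF) (h.face hF.1) N rfl, innerFaces_restrictFaces]
    rw [interiorPolytopeNumber_add_two, h.polytopeNumber_eq_of_properFaces hface,
      h.simplexSum_faces_eq_add, finsum_mem_congr rfl fun F hF => hface F hF N,
      add_sub_cancel_right]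

theorem IsApexTriangulation.polytopeNumber_eq (h : IsApexTriangulation P v K) (N : ℕ) :
    polytopeNumber v P (N + 2) = simplexSum K.faces N :=
  h.polytopeNumber_eq_of_properFaces (fun F hF N => by
    rw [(h.face hF.1).interiorPolytopeNumber_eq, innerFaces_restrictFaces]) N

end Recursion

end ApexTriangulation

section VisibleFacets

open Geometry

variable {E : Type*} [NormedAddCommGroup E] [NormedSpace ℝ E] {P F : Set E} {v : Set E → E}
  {K : SimplicialComplex ℝ E} {C : Set (Set E)} {s : Finset E} {x q : E}

theorem vectorSpan_eq_of_subset_affineSpan {A : Set E} (hAP : A ⊆ P)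
    (hPA : P ⊆ affineSpan ℝ A) : vectorSpan ℝ A = vectorSpan ℝ P := by
  refine le_antisymm (vectorSpan_mono ℝ hAP) ?_
  rw [← direction_affineSpan ℝ A, ← direction_affineSpan ℝ P]
  exact AffineSubspace.direction_le (affineSpan_le.2 hPA)

theorem card_eq_dim_add_one (hs : AffineIndependent ℝ ((↑) : s → E)) (hne : s.Nonempty)
    (hsP : (s : Set E) ⊆ P) (hPs : P ⊆ affineSpan ℝ (s : Set E)) : s.card = dim P + 1 := by
  have : Nonempty s := hne.to_subtype
  have h := hs.finrank_vectorSpan_add_one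
  rw [Subtype.range_coe_subtype, Finset.setOfPred_mem, Fintype.card_coe,
    vectorSpan_eq_of_subset_affineSpan hsP hPs] at h
  exact h.symm

theorem exists_baryCoord_nonneg_of_mem_vert (hs : AffineIndependent ℝ ((↑) : s → E))
    (hsP : (s : Set E) ⊆ P) (hx : x ∈ vert P) (hxs : x ∈ s) (hsx : s ≠ {x}) (hq : q ∈ P)
    (hqs : q ∈ affineSpan ℝ (s : Set E)) : ∃ y ∈ s, y ≠ x ∧ 0 ≤ baryCoord s y q := by
  -- Otherwise a linear form with its maximum over `P` only at `x` would be even larger at `q`.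
  by_contra! hneg
  obtain ⟨l, M, hM, hl⟩ := IsFace.exists_eq hx (Set.singleton_nonempty x)
  have hlt : ∀ y ∈ s, y ≠ x → l y < M := fun y hy hyx =>
    lt_of_le_of_ne (hM y (hsP hy)) fun he =>
      hyx (Set.mem_singleton_iff.1 (hl ▸ (⟨hsP hy, he⟩ : y ∈ {y ∈ P | l y = M})))
  have hlx : l x = M := (hl ▸ Set.mem_singleton x : x ∈ {y ∈ P | l y = M}).2
  have hlq : l q - M = ∑ y ∈ s, baryCoord s y q * (l y - M) := by
    simp only [mul_sub, Finset.sum_sub_distrib, ← Finset.sum_mul, sum_baryCoord hs hqs, one_mul]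
    conv_lhs => rw [← sum_baryCoord_smul hs hqs]
    simp only [map_sum, map_smul, smul_eq_mul]
  obtain ⟨y, hy, hyx⟩ : ∃ y ∈ s, y ≠ x := by
    by_contra! h
    exact hsx (Finset.eq_singleton_iff_unique_mem.2 ⟨hxs, h⟩)
  have hpos : 0 < ∑ y ∈ s, baryCoord s y q * (l y - M) := by
    refine Finset.sum_pos' (fun z hz => ?_)
      ⟨y, hy, mul_pos_of_neg_of_neg (hneg y hy hyx) (sub_neg.2 (hlt y hy hyx))⟩
    rcases eq_or_ne z x with rfl | hzx
    · rw [hlx, sub_self, mul_zero]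
    · exact mul_nonneg_of_nonpos_of_nonpos (hneg z hz hzx).le (sub_nonpos.2 (hlt z hz hzx).le)
  exact hpos.not_ge (hlq ▸ sub_nonpos.2 (hM q hq))

theorem card_visible_add_two_le (hs : AffineIndependent ℝ ((↑) : s → E))
    (hsP : (s : Set E) ⊆ P) (hvert : ∀ x ∈ s, x ∈ vert P) (hq : q ∈ P)
    (hqs : q ∈ affineSpan ℝ (s : Set E)) (hne : (visible q s).Nonempty) :
    (visible q s).card + 2 ≤ s.card := by
  classical
  obtain ⟨z, hz⟩ := hne
  obtain ⟨hzs, hz0⟩ := Finset.mem_filter.1 hz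
  obtain ⟨x, hxs, hx0⟩ : ∃ x ∈ s, 0 < baryCoord s x q := by
    by_contra! hle
    exact one_pos.not_ge ((sum_baryCoord hs hqs).symm.trans_le (Finset.sum_nonpos hle))
  have hsx : s ≠ {x} := by
    rintro rfl
    rw [Finset.mem_singleton.1 hzs] at hz0
    exact hx0.not_gt hz0
  obtain ⟨y, hys, hyx, hy0⟩ :=
    exists_baryCoord_nonneg_of_mem_vert hs hsP (hvert x hxs) hxs hsx hq hqs
  have hinvisible : ∀ w ∈ s, 0 ≤ baryCoord s w q → w ∈ s \ visible q s := fun w hw hw0 =>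
    Finset.mem_sdiff.2 ⟨hw, fun h => hw0.not_gt (Finset.mem_filter.1 h).2⟩
  have htwo : 1 < (s \ visible q s).card :=
    Finset.one_lt_card.2 ⟨y, hinvisible y hys hy0, x, hinvisible x hxs hx0.le, hyx⟩
  have hcard := Finset.card_sdiff_add_card_eq_card (visible_subset (q := q) (s := s))
  omega

/-- The number of full-dimensional faces of `K` of which exactly `i` facets are visible from `q`.
For generic `q` these numbers form the `h`-vector of `K`. -/
noncomputable def visibleCount (K : SimplicialComplex ℝ E) (q : E) (i : ℕ) : ℕ :=
  {s ∈ spanningFaces K | (visible q s).card = i}.ncard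

theorem IsGeneric.visibleCount_zero (hq : IsGeneric K q) (hfin : K.faces.Finite)
    (hK : Convex ℝ K.space) : visibleCount K q 0 = 1 := by
  obtain ⟨s, hs, huniq⟩ := hq.existsUnique_visible_eq_empty hfin hK
  simp only [visibleCount, Finset.card_eq_zero]
  exact Set.ncard_eq_one.2 ⟨s, Set.eq_singleton_iff_unique_mem.2 ⟨hs, huniq⟩⟩

theorem IsApexTriangulation.card_of_mem_spanningFaces (h : IsApexTriangulation P v K)
    (hs : s ∈ spanningFaces K) : s.card = dim P + 1 :=
  card_eq_dim_add_one (K.indep hs.1) (K.nonempty_of_mem_faces hs.1) (h.subset hs.1)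
    (h.space_eq ▸ hs.2)

variable [FiniteDimensional ℝ E]

theorem IsTriangulation.isApexTriangulation (hC : IsTriangulation P C) (hP : IsPolytope P)
    (hne : P.Nonempty) (hvert : ∀ F ∈ faces P, v F ∈ vert F)
    (hapex : ∀ F ∈ faces P, ∀ Q ∈ restrict C F, Q.Nonempty → dim Q = dim F → v F ∈ Q) :
    IsApexTriangulation P v hC.simplicialComplex where
  polytope := hP
  nonempty := hne
  finite := hC.finite_faces
  space_eq := hC.space_eq
  apex_mem_vert := hvert
  apex_mem F hF s hs hsF hFs := by
    have hsub : convexHull ℝ (s : Set E) ⊆ F := convexHull_min hsF (hP.of_isFace hF.1).convex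
    have hdim : dim (convexHull ℝ (s : Set E)) = dim F := by
      rw [dim, dim, vectorSpan_eq_of_subset_affineSpan hsub (by rwa [affineSpan_convexHull])]
    have hv := hapex F hF _ ⟨hs.2.2, hsub⟩ (Finset.coe_nonempty.2 hs.1).convexHull hdim
    exact vert_convexHull_subset _ ((hvert F hF).mono hsub (Set.singleton_subset_iff.2 hv))

namespace IsApexTriangulation

theorem mem_vert (h : IsApexTriangulation P v K) (hx : {x} ∈ K.faces) : x ∈ vert P := by
  induction hn : dim P using Nat.strong_induction_on generalizing P K with
  | h n ih =>
    obtain ⟨F, hF, hxF⟩ := h.polytope.exists_mem_innerFaces hx (h.subset hx)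
    by_cases hv : v P ∈ F
    · rw [← Finset.mem_singleton.1 (h.apex_mem_of_mem_innerFaces hF hv hxF)]
      exact h.apex_mem_vert P (self_mem_faces h.nonempty)
    · have hFP : F ≠ P := by
        rintro rfl
        exact hv h.apex_mem_self
      exact h.polytope.isFace_trans hF.1
        (ih _ (hn ▸ dim_lt_of_mem_properFaces ⟨hF, hFP⟩) (h.face hF) ⟨hx, hxF.2.1⟩ rfl)

theorem card_visible_mem (h : IsApexTriangulation P v K) (hq : q ∈ P)
    (hs : s ∈ spanningFaces K) :
    (visible q s).card ∈ insert 0 (Finset.Icc 1 (dim P - 1)) := by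
  rcases (visible q s).eq_empty_or_nonempty with h0 | h0
  · exact Finset.mem_insert.2 (Or.inl (Finset.card_eq_zero.2 h0))
  · have hvert : ∀ x ∈ s, x ∈ vert P := fun x hx => h.mem_vert
      (K.down_closed hs.1 (Finset.singleton_subset_iff.2 hx) (Finset.singleton_nonempty x))
    have hle := card_visible_add_two_le (K.indep hs.1) (h.subset hs.1) hvert hq
      (hs.2 (h.space_eq.symm ▸ hq)) h0
    rw [h.card_of_mem_spanningFaces hs] at hle
    have hpos := h0.card_pos
    exact Finset.mem_insert_of_mem (Finset.mem_Icc.2 ⟨hpos, by omega⟩)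

end IsApexTriangulation

end VisibleFacets

section SimplexNumbers

theorem simplexNumber_of_nonpos (d : ℕ) {m : ℤ} (hm : m ≤ 0) : simplexNumber d m = 0 := if_pos hm

theorem interiorSimplexNumber_eq_simplexNumber {d i : ℕ} (hi : i ≤ d) (N : ℕ) :
    interiorSimplexNumber (N + (d + 1 - i)) (d + 1) = simplexNumber d (((N + 2 : ℕ) : ℤ) - i) := by
  rw [interiorSimplexNumber, simplexNumber]
  split_ifs with h
  · exact Nat.choose_eq_zero_of_lt (by omega)
  · congr 1
    omega

theorem sum_mul_simplexNumber_eq_zero (a : ℕ → ℕ) (d : ℕ) {k n : ℕ} (hn : n ≤ 1) :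
    ∑ i ∈ Finset.Icc 1 k, (a i : ℤ) * simplexNumber d ((n : ℤ) - i) = 0 :=
  Finset.sum_eq_zero fun i hi => by
    have hi1 := (Finset.mem_Icc.1 hi).1
    rw [simplexNumber_of_nonpos d (by omega), Nat.cast_zero, mul_zero]

theorem finsum_mem_comp_eq_sum_ncard_mul {α ι : Type*} {S : Set α} (hS : S.Finite) {f : α → ι}
    {I : Finset ι} (hf : ∀ s ∈ S, f s ∈ I) (g : ι → ℤ) :
    ∑ᶠ s ∈ S, g (f s) = ∑ i ∈ I, ({s ∈ S | f s = i}.ncard : ℤ) * g i := by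
  classical
  rw [finsum_mem_eq_finite_toFinset_sum _ hS,
    ← Finset.sum_fiberwise_of_maps_to fun s hs => hf s (hS.mem_toFinset.1 hs)]
  refine Finset.sum_congr rfl fun i _ => ?_
  rw [Finset.sum_congr rfl fun s hs => congrArg g (Finset.mem_filter.1 hs).2, Finset.sum_const,
    nsmul_eq_mul, ← Set.ncard_coe_finset, Finset.coe_filter]
  simp only [hS.mem_toFinset]

open Geometry in
theorem IsApexTriangulation.polytopeNumber_eq_sum {E : Type*} [NormedAddCommGroup E]
    [NormedSpace ℝ E] [FiniteDimensional ℝ E] {P : Set E} {v : Set E → E}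
    {K : SimplicialComplex ℝ E} {q : E} (h : IsApexTriangulation P v K) (hq : IsGeneric K q)
    (N : ℕ) :
    polytopeNumber v P (N + 2) = simplexNumber (dim P) (N + 2 : ℕ) +
      ∑ i ∈ Finset.Icc 1 (dim P - 1),
        (visibleCount K q i : ℤ) * simplexNumber (dim P) (((N + 2 : ℕ) : ℤ) - i) := by
  have hvis : ∀ s ∈ spanningFaces K,
      (visible q s).card ∈ insert 0 (Finset.Icc 1 (dim P - 1)) := fun s hs =>
    h.card_visible_mem (h.space_eq ▸ hq.1) hs
  have hterm : ∀ s ∈ spanningFaces K,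
      interiorSimplexNumber (N + (s.card - (visible q s).card)) s.card =
        simplexNumber (dim P) (((N + 2 : ℕ) : ℤ) - (visible q s).card) := fun s hs => by
    have hle : (visible q s).card ≤ dim P := by
      have := hvis s hs
      rw [Finset.mem_insert, Finset.mem_Icc] at this
      omega
    rw [h.card_of_mem_spanningFaces hs, interiorSimplexNumber_eq_simplexNumber hle]
  calc polytopeNumber v P (N + 2)
      = ∑ᶠ s ∈ spanningFaces K,
          (simplexNumber (dim P) (((N + 2 : ℕ) : ℤ) - (visible q s).card) : ℤ) := by
        rw [h.polytopeNumber_eq, hq.simplexSum_faces h.finite h.convex_space]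
        exact finsum_mem_congr rfl fun s hs => congrArg _ (hterm s hs)
    _ = ∑ i ∈ insert 0 (Finset.Icc 1 (dim P - 1)),
          (visibleCount K q i : ℤ) * simplexNumber (dim P) (((N + 2 : ℕ) : ℤ) - i) :=
        finsum_mem_comp_eq_sum_ncard_mul (h.finite.subset (Set.sep_subset _ _)) hvis
          fun i => (simplexNumber (dim P) (((N + 2 : ℕ) : ℤ) - i) : ℤ)
    _ = _ := by
        rw [Finset.sum_insert (by simp), hq.visibleCount_zero h.finite h.convex_space]
        simp only [Nat.cast_one, one_mul, Nat.cast_zero, sub_zero]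

end SimplexNumbers

end PolytopeNumbers

open PolytopeNumbers

theorem mainTheorem1_general {E : Type*} [NormedAddCommGroup E] [NormedSpace ℝ E]
    [FiniteDimensional ℝ E] {d : ℕ} {P : Set E} (hP : IsDPolytope d P) {C : Set (Set E)}
    (hC : IsTriangulation P C) {v : Set E → E} (hvert : ∀ F ∈ faces P, v F ∈ vert F)
    (hapex : ∀ F ∈ faces P, ∀ Q ∈ restrict C F, Q.Nonempty → dim Q = dim F → v F ∈ Q) :
    ∃ a : ℕ → ℕ, ∀ n : ℕ, polytopeNumber v P n = (simplexNumber d n : ℤ) +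
      ∑ i ∈ Finset.Icc 1 (d - 1), (a i : ℤ) * (simplexNumber d ((n : ℤ) - (i : ℤ)) : ℤ) := by
  obtain ⟨hpoly, hne, rfl⟩ := hP
  have h := hC.isApexTriangulation hpoly hne hvert hapex
  obtain ⟨q, hq⟩ := exists_isGeneric h.finite h.convex_space (h.space_eq.symm ▸ hne)
  refine ⟨visibleCount hC.simplicialComplex q, fun n => ?_⟩
  match n with
  | 0 => rw [sum_mul_simplexNumber_eq_zero _ _ zero_le_one, polytopeNumber]; simp [simplexNumber]
  | 1 => rw [sum_mul_simplexNumber_eq_zero _ _ le_rfl, polytopeNumber]; simp [simplexNumber]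
  | N + 2 => exact h.polytopeNumber_eq_sum hq N

theorem mainTheorem1 {e d : ℕ} (P : Set (EuclideanSpace ℝ (Fin e)))
    (hP : PolytopeNumbers.IsDPolytope d P)
    (C : Set (Set (EuclideanSpace ℝ (Fin e))))
    (v : Set (EuclideanSpace ℝ (Fin e)) → EuclideanSpace ℝ (Fin e))
    (hC : PolytopeNumbers.IsPointedTriangulation P v C) :
    ∃ a : ℕ → ℕ, ∀ n : ℕ,
      PolytopeNumbers.polytopeNumber v P n =
        (PolytopeNumbers.simplexNumber d n : ℤ) +
          ∑ i ∈ Finset.Icc 1 (d - 1),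
            (a i : ℤ) * (PolytopeNumbers.simplexNumber d ((n : ℤ) - (i : ℤ)) : ℤ) :=
  mainTheorem1_general hP hC.triangulation hC.apex_mem_vert hC.apex_mem
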